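/- **Theorem (Pointwise worst-case prediction error of the computation-aware RTS smoother).** *Prior.* Let $\mathcal X$ be a set, $\mathbb T=[t_{\min},t_{\max}]$, $\mathcal Z=\mathbb T\times\mathcal X$, $D'\ge 1$. Let $\boldsymbol f$ be a $D'$-output space-time separable Gauss–Markov process on $\mathcal Z$: a Gaussian process with mean $\boldsymbol\mu^t(t)\,\mu^{x}(x)$ and covariance $\boldsymbol\Sigma^t(t,t')\,\Sigma^{x}(x,x')$, where $\mathcal{GP}(\boldsymbol\mu^t,\boldsymbol\Sigma^t)$ is a $D'$-output Markov process $\boldsymbol f^t$ with transitions $\boldsymbol f^t(t)\mid \boldsymbol f^t(s)\sim\mathcal N(A^t(t,s)\boldsymbol f^t(s)+b^t(t,s),Q^t(t,s))$, $s\le t$. Let $\mu,\Sigma$ be the mean and covariance functions of the component $\boldsymbol f_0$. For $\sigma^2\ge 0$ put $\Sigma^\sigma(z,z')=\Sigma(z,z')+\sigma^2\delta(z,z')$, with reproducing kernel Hilbert space $\mathbb H_{\Sigma^\sigma}$. *Data.* Let $t_1<\dots<t_n$ be in $\mathbb T$, let $t_0\in\mathbb T$ be an initial time with $t_0\le t_1$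 (if $n\ge1$), and let $x_{k,1},\dots,x_{k,N_k}\in\mathcal X$ ($1\le k\le n$), pairwise distinct for each $k$ if $\sigma^2>0$. The training inputs are $Z^{\rm train}=\{(t_k,x_{k,i})\}$; a function $y:\mathcal Z\to\mathbb R$ gives the targets $y_k=(y(t_k,x_{k,i}))_i\in\mathbb R^{N_k}$. Let $S_k\in\mathbb R^{N_k\times\check N_k}$ be arbitrary action matrices; they are held fixed, i.e. they are the same for all $y$ below. *Smoother.* Let $z=(t,x)\in\mathcal Z$ be a test input and let $X=(X_1,\dots,X_{N_X})$ be a finite family of points of $\mathcal X$ containing $x$ and all $x_{k,i}$. Put $u(t)=\boldsymbol f(t,X)$, with mean $\mu_u(t)=\boldsymbol\mu^t(t)\otimes\mu^x(X)$, covariance $\Sigma_u(t)=\boldsymbol\Sigma^t(t,t)\otimes\Sigma^x(X,X)$ and transition coefficients $A(t,s)=A^t(t,s)\otimes I$, $b(t,s)=b^t(t,s)\otimes\mu^x(X)$; let $H_k$ be the selection matrix with $H_ku(t_k)=\boldsymbol f_0(t_k,(x_{k,i})_i)$. Write $A_k=A(t_{k+1},t_k)$, $b_k=b(t_{k+1},t_k)$,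 let $\dagger$ be the Moore–Penrose inverse, and let $(\,)$ be the matrix without columns. The filter (CAKF) starts from $m_0=\mu_u(t_0)$, $M_0=(\,)$, and for $k=1,\dots,n$ computes $m_k^-=A_{k-1}m_{k-1}+b_{k-1}$, $M_k^-=A_{k-1}M_{k-1}$, $P_k^-=\Sigma_u(t_k)-M_k^-(M_k^-)^\top$, $\check H_k=S_k^\top H_k$, $\check G_k=\check H_kP_k^-\check H_k^\top+\sigma^2S_k^\top S_k$, a matrix $\check V_k$ with $\check V_k\check V_k^\top=\check G_k^\dagger$, then $w_k=\check H_k^\top\check G_k^\dagger(S_k^\top y_k-\check H_km_k^-)$, $W_k=\check H_k^\top\check V_k$, $m_k=m_k^-+P_k^-w_k$, $M_k=(M_k^-\;\;P_k^-W_k)$ and $P_k=\Sigma_u(t_k)-M_kM_k^\top$. The smoother (CAKS), without truncation, starts from $w_n^s=w_n$, $W_n^s=W_n$, $m_n^s=m_n$, $M_n^s=M_n$, and for $k=n-1,\dots,0$ computes $m_k^s=m_k+P_kA_k^\top w_{k+1}^s$, $M_k^s=(M_k\;\;P_kA_k^\top W^s_{k+1})$ and, with $B_k=(I-W_kW_k^\top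 P_k^-)A_k^\top$, $w_k^s=w_k+B_kw_{k+1}^s$, $W_k^s=(W_k\;\;B_kW_{k+1}^s)$; the pair $(w^s_0,W^s_0)$ is not used. For arbitrary $t\in\mathbb T$ let $k$ be the largest index in $\{1,\dots,n\}$ with $t_k\le t$, or $k=0$ if there is none. If $t=t_k$ put $m^s(t)=m^s_k$, $M^s(t)=M^s_k$. Otherwise let $m(t)=A(t,t_k)m_k+b(t,t_k)$, $M(t)=A(t,t_k)M_k$ if $k\ge1$, and $m(t)=\mu_u(t)$, $M(t)=(\,)$ if $k=0$; if $k=n$ put $m^s(t)=m(t)$, $M^s(t)=M(t)$, and if $k<n$ put $B=(\Sigma_u(t)-M(t)M(t)^\top)A(t_{k+1},t)^\top$, $m^s(t)=m(t)+Bw^s_{k+1}$, $M^s(t)=(M(t)\;\;BW^s_{k+1})$. Let $\hat m(z\mid y)_0$ be the entry of $m^s(t)$, and $\hat P(z)_{0,0}$ the diagonal entry of $\Sigma_u(t)-M^s(t)M^s(t)^\top$, belonging to output $0$ and spatial point $x$. The number $\hat P(z)_{0,0}$ does not depend on $y$. *Claim.* If $z\notin Z^{\rm train}$, or if $\sigma^2=0$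 and $z\in\mathcal Z$ is arbitrary, then $\hat P(z)_{0,0}+\sigma^2\ge0$ and $$\sup_{g\in\mathbb H_{\Sigma^\sigma}\setminus\{0\}}\frac{\bigl|(\mu+g)(z)-\hat m(z\mid\mu+g)_0\bigr|}{\|g\|_{\mathbb H_{\Sigma^\sigma}}}=\sqrt{\hat P(z)_{0,0}+\sigma^2}.$$ In particular, if the prior mean $\mu$ is zero, $$\sup_{y\in\mathbb H_{\Sigma^\sigma}\setminus\{0\}}\frac{\bigl|y(z)-\hat m(z\mid y)_0\bigr|}{\|y\|_{\mathbb H_{\Sigma^\sigma}}}=\sqrt{\hat P(z)_{0,0}+\sigma^2}.$$ (Suprema are taken in $[0,\infty]$, so the supremum over the empty set is $0$.) -/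

import Mathlib

open MeasureTheory ProbabilityTheory Matrix

noncomputable section

namespace CAKS

/-! ### Pseudo-inverses and left square roots -/

/-- `B` is the Moore–Penrose pseudo-inverse of the real matrix `A` (the four Penrose conditions). -/
structure IsMoorePenrose {m n : Type*} [Fintype m] [Fintype n]
    (A : Matrix m n ℝ) (B : Matrix n m ℝ) : Prop where
  mul_mul_self : A * B * A = A
  self_mul_mul : B * A * B = B
  left_symm : (A * B)ᵀ = A * B
  right_symm : (B * A)ᵀ = B * A

theorem exists_isMoorePenrose_of_isHermitian {n : Type*} [Fintype n] [DecidableEq n]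
    {A : Matrix n n ℝ} (hA : A.IsHermitian) : ∃ B, IsMoorePenrose A B ∧ Bᵀ = B := by
  obtain ⟨U, e, hUU, hdec⟩ : ∃ (U : Matrix n n ℝ) (e : n → ℝ), Uᵀ * U = 1 ∧
      A = U * diagonal e * Uᵀ := by
    refine ⟨(hA.eigenvectorUnitary : Matrix n n ℝ), hA.eigenvalues, ?_, ?_⟩
    · have := Unitary.coe_star_mul_self hA.eigenvectorUnitary
      simpa [star_eq_conjTranspose] using this
    · have := hA.spectral_theorem
      rw [Unitary.conjStarAlgAut_apply] at this
      conv_lhs => rw [this]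
      simp [star_eq_conjTranspose]
  have key : ∀ p q : n → ℝ, (U * diagonal p * Uᵀ) * (U * diagonal q * Uᵀ)
      = U * diagonal (fun i => p i * q i) * Uᵀ := by
    intro p q
    calc (U * diagonal p * Uᵀ) * (U * diagonal q * Uᵀ)
        = U * diagonal p * (Uᵀ * U) * diagonal q * Uᵀ := by simp only [Matrix.mul_assoc]
      _ = U * (diagonal p * diagonal q) * Uᵀ := by rw [hUU]; simp only [Matrix.mul_one, Matrix.mul_assoc]
      _ = _ := by rw [diagonal_mul_diagonal]
  have ksymm : ∀ p : n → ℝ, (U * diagonal p * Uᵀ)ᵀ = U * diagonal p * Uᵀ := by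
    intro p
    simp [Matrix.transpose_mul, Matrix.mul_assoc]
  subst hdec
  refine ⟨U * diagonal (fun i => (e i)⁻¹) * Uᵀ, ⟨?_, ?_, ?_, ?_⟩, ksymm _⟩
  · rw [key, key]
    simp
  · rw [key, key]
    congr 3
    ext i
    by_cases h : e i = 0 <;> simp [h]
  · rw [key, ksymm]
  · rw [key, ksymm]

/-- Every real matrix has a Moore–Penrose pseudo-inverse. -/
theorem exists_isMoorePenrose {m n : Type*} [Fintype m] [Fintype n] (A : Matrix m n ℝ) :
    ∃ B, IsMoorePenrose A B := by
  classical
  have hG : (Aᵀ * A).IsHermitian := by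
    simpa [conjTranspose_eq_transpose_of_trivial] using isHermitian_conjTranspose_mul_self A
  obtain ⟨K, hK, hKs⟩ := exists_isMoorePenrose_of_isHermitian hG
  have hzero : A * K * (Aᵀ * A) - A = 0 := by
    rw [← conjTranspose_mul_self_eq_zero, conjTranspose_eq_transpose_of_trivial]
    have h1 : (A * K * (Aᵀ * A) - A)ᵀ * A = 0 := by
      have : (A * K * (Aᵀ * A) - A)ᵀ * A = (Aᵀ * A) * K * (Aᵀ * A) - Aᵀ * A := by
        simp only [transpose_sub, transpose_mul, transpose_transpose, hKs, Matrix.sub_mul,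
          Matrix.mul_assoc]
      rw [this, hK.mul_mul_self, sub_self]
    have h2 : A * K * (Aᵀ * A) - A = A * (K * (Aᵀ * A) - 1) := by
      rw [Matrix.mul_sub, Matrix.mul_one, Matrix.mul_assoc]
    rw [h2, ← Matrix.mul_assoc, ← h2, h1, Matrix.zero_mul]
  refine ⟨K * Aᵀ, ⟨?_, ?_, ?_, ?_⟩⟩
  · rw [← sub_eq_zero, ← hzero]
    simp only [Matrix.mul_assoc]
  · have := congrArg (· * Aᵀ) hK.self_mul_mul
    simpa only [Matrix.mul_assoc] using this
  · simp only [transpose_mul, transpose_transpose, hKs, Matrix.mul_assoc]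
  · have := hK.right_symm
    simpa only [Matrix.mul_assoc] using this

/-- The Moore–Penrose pseudo-inverse `A†`. -/
def pinv {m n : Type*} [Fintype m] [Fintype n] (A : Matrix m n ℝ) : Matrix n m ℝ :=
  (exists_isMoorePenrose A).choose

theorem isMoorePenrose_pinv {m n : Type*} [Fintype m] [Fintype n] (A : Matrix m n ℝ) :
    IsMoorePenrose A (pinv A) :=
  (exists_isMoorePenrose A).choose_spec

open scoped MatrixOrder in
/-- Every positive semidefinite matrix has a left square root. -/
theorem exists_lsqrt {n : Type*} [Fintype n] [DecidableEq n] {A : Matrix n n ℝ}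
    (hA : A.PosSemidef) : ∃ V : Matrix n n ℝ, V * Vᵀ = A := by
  refine ⟨CFC.sqrt A, ?_⟩
  have h : (CFC.sqrt A)ᵀ = CFC.sqrt A := by
    have := (CFC.sqrt_nonneg A).posSemidef.isHermitian.eq
    simpa [conjTranspose_eq_transpose_of_trivial] using this
  rw [h]
  exact CFC.sqrt_mul_sqrt_self A hA.nonneg

open Classical in
/-- A left square root: some `V` with `V * Vᵀ = A` (it exists when `A` is positive semidefinite;
the value is `0` if there is none). -/
def lsqrt {n : Type*} [Fintype n] (A : Matrix n n ℝ) : Matrix n n ℝ :=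
  if h : ∃ V : Matrix n n ℝ, V * Vᵀ = A then h.choose else 0

theorem lsqrt_mul_transpose {n : Type*} [Fintype n] [DecidableEq n] {A : Matrix n n ℝ}
    (hA : A.PosSemidef) : lsqrt A * (lsqrt A)ᵀ = A := by
  have h := exists_lsqrt hA
  rw [lsqrt, dif_pos h]
  exact h.choose_spec

/-! ### Downdate matrices: matrices with `D` rows and a variable number of columns -/

/-- A matrix with rows indexed by `D` and some finite number of columns. -/
structure Columns (D : Type*) where
  rank : ℕ
  mat : Matrix D (Fin rank) ℝ

namespace Columns

variable {D : Type*}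

/-- The matrix without columns. -/
def empty : Columns D := ⟨0, Matrix.of fun _ j => j.elim0⟩

/-- The block matrix `(L  B)`. -/
def append (L B : Columns D) : Columns D :=
  ⟨L.rank + B.rank, (Matrix.fromCols L.mat B.mat).submatrix id finSumFinEquiv.symm⟩

/-- The product `A * L`. -/
def lmul [Fintype D] (A : Matrix D D ℝ) (L : Columns D) : Columns D := ⟨L.rank, A * L.mat⟩

/-- The matrix `L * Lᵀ`. -/
def gram (L : Columns D) : Matrix D D ℝ := L.mat * L.matᵀ

theorem gram_empty : (empty : Columns D).gram = 0 := by
  have : IsEmpty (Fin (empty : Columns D).rank) := inferInstanceAs (IsEmpty (Fin 0))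
  ext i j
  simp [gram, Matrix.mul_apply]

theorem gram_append (L B : Columns D) : (L.append B).gram = L.gram + B.gram := by
  ext i j
  change ∑ c : Fin (L.rank + B.rank), _ = _
  rw [← finSumFinEquiv.sum_comp]
  simp [gram, append, Matrix.mul_apply, Matrix.add_apply]

end Columns

/-! ### The computation-aware Kalman filter and smoother -/

/-- The prior of a latent Gauss–Markov process `u` in continuous time, as it enters the filter:
`mean t` and `cov t` are the marginal mean and covariance of `u(t)`, and `trans t s = A(t, s)`,
`offset t s = b(t, s)` are the coefficients of the transition `u(s) ↦ u(t)`. -/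
structure PriorModel (T D : Type*) where
  mean : T → D → ℝ
  cov : T → Matrix D D ℝ
  trans : T → T → Matrix D D ℝ
  offset : T → T → D → ℝ

/-- Projected linear observations `(S k)ᵀ * y k`, where `y k = H k * u(time k) + ε k` and
`ε k` has covariance `noiseCov k`, for `k = 1, …, num`. Here `time 0` is the initial time of the
filter, and the columns of `S k` are the actions of time step `k`. -/
structure ObsModel (T D : Type*) where
  num : ℕ
  time : ℕ → T
  dim : ℕ → ℕ
  numAct : ℕ → ℕ
  H : ∀ k, Matrix (Fin (dim k)) D ℝ
  noiseCov : ∀ k, Matrix (Fin (dim k)) (Fin (dim k)) ℝ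
  S : ∀ k, Matrix (Fin (dim k)) (Fin (numAct k)) ℝ

/-- The quantities computed by the filter at one time step: predictive mean `m⁻` and downdate `M⁻`,
filter mean `m` and downdate `M`, and the vectors `w` and matrices `W` of the update. -/
structure FilterState (D : Type*) where
  predMean : D → ℝ
  predDown : Columns D
  mean : D → ℝ
  down : Columns D
  w : D → ℝ
  W : Columns D

section Algorithm

variable {T D : Type*} [Fintype D] [DecidableEq D]

/-- The update step: from the predictive mean `m⁻` and downdate `M⁻`, the prior covariance `Sig`,
and `H`, `Lam`, `S`, `y`. -/
def update {N n : ℕ} (pm : D → ℝ) (pM : Columns D) (Sig : Matrix D D ℝ)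
    (H : Matrix (Fin N) D ℝ) (Lam : Matrix (Fin N) (Fin N) ℝ) (S : Matrix (Fin N) (Fin n) ℝ)
    (y : Fin N → ℝ) : FilterState D :=
  let P : Matrix D D ℝ := Sig - pM.gram
  let Hc : Matrix (Fin n) D ℝ := Sᵀ * H
  let Lc : Matrix (Fin n) (Fin n) ℝ := Sᵀ * Lam * S
  let yc : Fin n → ℝ := Sᵀ *ᵥ y
  let G : Matrix (Fin n) (Fin n) ℝ := Hc * P * Hcᵀ + Lc
  let V : Matrix (Fin n) (Fin n) ℝ := lsqrt (pinv G)
  let w : D → ℝ := Hcᵀ *ᵥ (pinv G *ᵥ (yc - Hc *ᵥ pm))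
  let W : Columns D := ⟨n, Hcᵀ * V⟩
  { predMean := pm
    predDown := pM
    mean := pm + P *ᵥ w
    down := pM.append (W.lmul P)
    w := w
    W := W }

variable (p : PriorModel T D) (o : ObsModel T D) (y : ∀ k, Fin (o.dim k) → ℝ)

/-- The computation-aware Kalman filter, without truncation: start from the prior at the initial
time, then alternate prediction and update. (No data at step `0`: `w` and `W` are trivial.) -/
def cakf : ℕ → FilterState D
  | 0 =>
    { predMean := p.mean (o.time 0)
      predDown := Columns.empty
      mean := p.mean (o.time 0)
      down := Columns.empty
      w := 0
      W := Columns.empty }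
  | k + 1 =>
    update
      (p.trans (o.time (k + 1)) (o.time k) *ᵥ (cakf k).mean + p.offset (o.time (k + 1)) (o.time k))
      ((cakf k).down.lmul (p.trans (o.time (k + 1)) (o.time k)))
      (p.cov (o.time (k + 1))) (o.H (k + 1)) (o.noiseCov (k + 1)) (o.S (k + 1)) (y (k + 1))

/-- The predictive covariance `P⁻` of the filter at step `k`. -/
def cakfPredCov (k : ℕ) : Matrix D D ℝ := p.cov (o.time k) - (cakf p o y k).predDown.gram

/-- The covariance `P` of the filter at step `k`. -/
def cakfCov (k : ℕ) : Matrix D D ℝ := p.cov (o.time k) - (cakf p o y k).down.gram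

/-- The backward recursion for the pair `(w^s, W^s)` of the smoother, without truncation, started
at step `k + j`, where the pair equals `(w, W)` of the filter, and run back to step `k`. -/
def smootherPairFrom : ℕ → ℕ → (D → ℝ) × Columns D
  | k, 0 => ((cakf p o y k).w, (cakf p o y k).W)
  | k, j + 1 =>
    let next := smootherPairFrom (k + 1) j
    let B : Matrix D D ℝ := (1 - (cakf p o y k).W.gram * cakfPredCov p o y k) *
      (p.trans (o.time (k + 1)) (o.time k))ᵀ
    ((cakf p o y k).w + B *ᵥ next.1, (cakf p o y k).W.append (next.2.lmul B))

/-- The pair `(w^s, W^s)` of the smoother at step `k ≤ num`. -/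
def smootherPair (k : ℕ) : (D → ℝ) × Columns D := smootherPairFrom p o y k (o.num - k)

/-- The smoother mean `m^s` and downdate `M^s` at the time of step `k ≤ num`. -/
def caksStep (k : ℕ) : (D → ℝ) × Columns D :=
  if k < o.num then
    let B : Matrix D D ℝ := cakfCov p o y k * (p.trans (o.time (k + 1)) (o.time k))ᵀ
    ((cakf p o y k).mean + B *ᵥ (smootherPair p o y (k + 1)).1,
      (cakf p o y k).down.append ((smootherPair p o y (k + 1)).2.lmul B))
  else ((cakf p o y k).mean, (cakf p o y k).down)

variable [LinearOrder T]

/-- The last step `k ∈ {1, …, num}` with `time k ≤ t`, and `0` if there is none. -/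
def lastStep (t : T) : ℕ := Nat.findGreatest (fun k => o.time k ≤ t) o.num

/-- Filter interpolation: mean and downdate of the filter at an arbitrary time `t`. -/
def cakfAt (t : T) : (D → ℝ) × Columns D :=
  let k := lastStep o t
  if t = o.time k then ((cakf p o y k).mean, (cakf p o y k).down)
  else if k < 1 then (p.mean t, Columns.empty)
  else (p.trans t (o.time k) *ᵥ (cakf p o y k).mean + p.offset t (o.time k),
    (cakf p o y k).down.lmul (p.trans t (o.time k)))

/-- Smoother interpolation: mean and downdate of the smoother at an arbitrary time `t`. -/
def caksAt (t : T) : (D → ℝ) × Columns D :=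
  let k := lastStep o t
  if t = o.time k then caksStep p o y k
  else if k < o.num then
    let B : Matrix D D ℝ :=
      (p.cov t - (cakfAt p o y t).2.gram) * (p.trans (o.time (k + 1)) t)ᵀ
    ((cakfAt p o y t).1 + B *ᵥ (smootherPair p o y (k + 1)).1,
      (cakfAt p o y t).2.append ((smootherPair p o y (k + 1)).2.lmul B))
  else cakfAt p o y t

/-- The mean of the computation-aware smoother at time `t`. -/
def smootherMean (t : T) : D → ℝ := (caksAt p o y t).1

/-- The covariance of the computation-aware smoother at time `t`. -/
def smootherCov (t : T) : Matrix D D ℝ := p.cov t - (caksAt p o y t).2.gram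

end Algorithm

/-! ### Space-time separable Gauss–Markov processes -/

/-- `f` is a `d`-output Gaussian process with mean function `m` and covariance function `C`. -/
structure IsGP {I Ω : Type*} [MeasurableSpace Ω] {d : ℕ} (f : I → Ω → EuclideanSpace ℝ (Fin d))
    (m : I → Fin d → ℝ) (C : I → I → Matrix (Fin d) (Fin d) ℝ) (P : Measure Ω) : Prop where
  measurable : ∀ i, Measurable (f i)
  gaussian : IsGaussianProcess f P
  mean_eq : ∀ i a, ∫ ω, f i ω a ∂P = m i a
  cov_eq : ∀ i j a b, covariance (fun ω => f i ω a) (fun ω => f j ω b) P = C i j a b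

open scoped MatrixOrder in
/-- The kernel sending a path `x` up to time `s` to `N(A x(s) + b, Q)`. -/
def gaussianTransition {T : Type*} [LinearOrder T] {d : ℕ} (A : Matrix (Fin d) (Fin d) ℝ)
    (b : Fin d → ℝ) (Q : Matrix (Fin d) (Fin d) ℝ) (s : T) :
    Kernel (Set.Iic s → EuclideanSpace ℝ (Fin d)) (EuclideanSpace ℝ (Fin d)) where
  toFun x := multivariateGaussian (WithLp.toLp 2 (A *ᵥ (x ⟨s, le_refl s⟩).ofLp + b)) Q
  measurable' := by
    let c : (Set.Iic s → EuclideanSpace ℝ (Fin d)) → EuclideanSpace ℝ (Fin d) :=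
      fun x => WithLp.toLp 2 (A *ᵥ (x ⟨s, le_refl s⟩).ofLp + b)
    have hc : Measurable c := by
      have h1 : Continuous fun v : EuclideanSpace ℝ (Fin d) =>
          (WithLp.toLp 2 (A *ᵥ v.ofLp + b) : EuclideanSpace ℝ (Fin d)) := by fun_prop
      exact h1.measurable.comp (measurable_pi_apply _)
    let g : EuclideanSpace ℝ (Fin d) → EuclideanSpace ℝ (Fin d) :=
      fun v => toEuclideanCLM (𝕜 := ℝ) (CFC.sqrt Q) v
    have hg : Measurable g := (toEuclideanCLM (𝕜 := ℝ) (CFC.sqrt Q)).continuous.measurable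
    have h : (fun x => multivariateGaussian (c x) Q) =
        fun x => ((stdGaussian (EuclideanSpace ℝ (Fin d))).map (Prod.mk x)).map
          (fun q : (Set.Iic s → EuclideanSpace ℝ (Fin d)) × EuclideanSpace ℝ (Fin d) =>
            c q.1 + g q.2) := by
      funext x
      rw [Measure.map_map (by fun_prop) (by fun_prop)]
      rfl
    change Measurable (fun x => multivariateGaussian (c x) Q)
    rw [h]
    exact (Measure.measurable_map _ (by fun_prop)).comp Measurable.map_prodMk_left

instance {T : Type*} [LinearOrder T] {d : ℕ} (A : Matrix (Fin d) (Fin d) ℝ)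
    (b : Fin d → ℝ) (Q : Matrix (Fin d) (Fin d) ℝ) (s : T) :
    IsMarkovKernel (gaussianTransition A b Q s) where
  isProbabilityMeasure x := by
    change IsProbabilityMeasure (multivariateGaussian _ Q)
    infer_instance

/-- The process `f` is Markov with Gaussian transitions
`f(t) | f(s) ∼ N(A(t, s) f(s) + b(t, s), Q(t, s))`: for `s ≤ t`, the conditional law of `f(t)` given
the past `(f(r))_{r ≤ s}` is that normal distribution. -/
structure IsGaussMarkov {T Ω : Type*} [LinearOrder T] [MeasurableSpace Ω] {d : ℕ}
    (f : T → Ω → EuclideanSpace ℝ (Fin d)) (P : Measure Ω)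
    (A : T → T → Matrix (Fin d) (Fin d) ℝ) (b : T → T → Fin d → ℝ)
    (Q : T → T → Matrix (Fin d) (Fin d) ℝ) : Prop where
  posSemidef : ∀ s t, s ≤ t → (Q t s).PosSemidef
  transition : ∀ s t, s ≤ t →
    HasCondDistrib (f t) (fun ω (r : Set.Iic s) => f r ω)
      (gaussianTransition (A t s) (b t s) (Q t s) s) P

/-- The separable mean function `(t, x) ↦ μx(x) • μt(t)`. -/
def sepMean {T X : Type*} {d : ℕ} (μt : T → Fin d → ℝ) (μx : X → ℝ) : T × X → Fin d → ℝ :=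
  fun z => μx z.2 • μt z.1

/-- The separable covariance function `((t, x), (t', x')) ↦ Cx(x, x') • Ct(t, t')`. -/
def sepCov {T X : Type*} {d : ℕ} (Ct : T → T → Matrix (Fin d) (Fin d) ℝ) (Cx : X → X → ℝ) :
    T × X → T × X → Matrix (Fin d) (Fin d) ℝ :=
  fun z z' => Cx z.2 z'.2 • Ct z.1 z'.1

/-- `f` is a space-time separable Gauss–Markov process: it is a Gaussian process with separable mean
and covariance functions, whose temporal factors are the mean and covariance functions of a
Gaussian process `ft` that is Markov with transition coefficients `A`, `b`, `Q`. -/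
structure IsSTSGMP {T X Ω Ω' : Type*} [LinearOrder T] [MeasurableSpace Ω] [MeasurableSpace Ω']
    {d : ℕ} (f : T × X → Ω → EuclideanSpace ℝ (Fin d)) (P : Measure Ω)
    (ft : T → Ω' → EuclideanSpace ℝ (Fin d)) (P' : Measure Ω')
    (μt : T → Fin d → ℝ) (μx : X → ℝ)
    (Ct : T → T → Matrix (Fin d) (Fin d) ℝ) (Cx : X → X → ℝ)
    (A : T → T → Matrix (Fin d) (Fin d) ℝ) (b : T → T → Fin d → ℝ)
    (Q : T → T → Matrix (Fin d) (Fin d) ℝ) : Prop where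
  separable : IsGP f (sepMean μt μx) (sepCov Ct Cx) P
  temporal : IsGP ft μt Ct P'
  markov : IsGaussMarkov ft P' A b Q

/-! ### Spatiotemporal regression -/

open Classical in
/-- The kernel `K + σ² δ` of the noisy process. -/
def noisyKernel {Z : Type*} (K : Z → Z → ℝ) (σ : ℝ) (z z' : Z) : ℝ :=
  K z z' + if z = z' then σ ^ 2 else 0

section Regression

variable {T X : Type*} {d n : ℕ}

/-- The state-space form `u(t) = f(t, grid)`, with state index set `Fin d × Fin n`, of a space-time
separable Gauss–Markov process on a grid of `n` spatial points. -/
def gridPrior (μt : T → Fin d → ℝ) (μx : X → ℝ)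
    (Ct : T → T → Matrix (Fin d) (Fin d) ℝ) (Cx : X → X → ℝ)
    (A : T → T → Matrix (Fin d) (Fin d) ℝ) (b : T → T → Fin d → ℝ) (grid : Fin n → X) :
    PriorModel T (Fin d × Fin n) where
  mean t := fun c => μt t c.1 * μx (grid c.2)
  cov t := Matrix.kronecker (Ct t t) (Matrix.of fun i j => Cx (grid i) (grid j))
  trans t s := Matrix.kronecker (A t s) (1 : Matrix (Fin n) (Fin n) ℝ)
  offset t s := fun c => b t s c.1 * μx (grid c.2)

/-- Observations of the zeroth output at the grid points `loc k i`, `i < N k`, at the times `τ k`,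
with i.i.d. noise of variance `σ²`. -/
def gridObs [NeZero d] (σ : ℝ) (nt : ℕ) (τ : ℕ → T) (N : ℕ → ℕ) (loc : ∀ k, Fin (N k) → Fin n)
    (nAct : ℕ → ℕ) (S : ∀ k, Matrix (Fin (N k)) (Fin (nAct k)) ℝ) :
    ObsModel T (Fin d × Fin n) where
  num := nt
  time := τ
  dim := N
  numAct := nAct
  H k := Matrix.of fun i c => if c = ((0 : Fin d), loc k i) then 1 else 0
  noiseCov _ := σ ^ 2 • 1
  S := S

end Regression

end CAKS

end

noncomputable section

namespace CAKS

/-! ### Pseudo-inverses of symmetric matrices -/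

/-! With the actions fixed, the smoother mean at `z` is affine in the data: it equals `μ z + ∑ q, c
q * (y (pt q) - μ (pt q))` with weights `c` that do not depend on `y`. For `y = μ + g` the
prediction error is therefore `g z - ∑ q, c q * g (pt q)`. By the reproducing property this is the
inner product of `g` with `h`, the kernel section at `z` minus the `c`-combination of the sections
at the training points. The supremum is the operator norm of that functional, which is `‖h‖`.
Expanding `‖h‖ ^ 2` gives the mean squared error of the linear predictor with weights `c`, plus `σ ^
2`. The noise enters the square at `z` but not the cross terms, because `z` is not a training point
or `σ = 0`.

It remains to see that the smoother covariance is the error covariance of the smoother's own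
weights. `postCov` and `postWeight` condition step by step on the projected data, as functions of
all times at once. Bilinear algebra identifies `postCov` with the error covariance of `postWeight`
(`IsObsCov.errorCov_postWeight`); the Gram matrix of the kernel sections serves as covariance of the
observations. The Markov property of the prior, in the form `K t s = A(t, r) * K r s` for `s ≤ r ≤
t`, survives conditioning on observations up to time `r`. It turns the filter and the backward
recursion into evaluations of these functions (`cakf_spec`, `smootherPair_spec`, `caksAt_spec`).
Probability enters only in deriving this moment identity, and the corresponding one for the mean,
from the Gaussian transitions. -/

theorem IsMoorePenrose.unique {m n : Type*} [Fintype m] [Fintype n] {A : Matrix m n ℝ}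
    {B C : Matrix n m ℝ} (hB : IsMoorePenrose A B) (hC : IsMoorePenrose A C) : B = C := by
  have h1 : A * B = A * C := by
    calc A * B = (A * C * A) * B := by rw [hC.mul_mul_self]
      _ = (A * C)ᵀ * (A * B)ᵀ := by rw [hC.left_symm, hB.left_symm, Matrix.mul_assoc]
      _ = ((A * B * A) * C)ᵀ := by rw [← transpose_mul, Matrix.mul_assoc (A * B)]
      _ = A * C := by rw [hB.mul_mul_self, hC.left_symm]
  have h2 : B * A = C * A := by
    calc B * A = B * (A * C * A) := by rw [hC.mul_mul_self]
      _ = (B * A)ᵀ * (C * A)ᵀ := by rw [hC.right_symm, hB.right_symm]; simp only [Matrix.mul_assoc]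
      _ = (C * (A * B * A))ᵀ := by rw [← transpose_mul]; simp only [Matrix.mul_assoc]
      _ = C * A := by rw [hB.mul_mul_self, hC.right_symm]
  calc B = B * A * B := hB.self_mul_mul.symm
    _ = C * A * C := by rw [h2, Matrix.mul_assoc, h1, Matrix.mul_assoc]
    _ = C := hC.self_mul_mul

theorem IsMoorePenrose.transpose {m n : Type*} [Fintype m] [Fintype n] {A : Matrix m n ℝ}
    {B : Matrix n m ℝ} (h : IsMoorePenrose A B) : IsMoorePenrose Aᵀ Bᵀ where
  mul_mul_self := by
    rw [← transpose_mul, ← transpose_mul, ← Matrix.mul_assoc, h.mul_mul_self]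
  self_mul_mul := by
    rw [← transpose_mul, ← transpose_mul, ← Matrix.mul_assoc, h.self_mul_mul]
  left_symm := by rw [← transpose_mul, h.right_symm, h.right_symm]
  right_symm := by rw [← transpose_mul, h.left_symm, h.left_symm]

theorem pinv_transpose_of_symm {n : Type*} [Fintype n] {A : Matrix n n ℝ} (hA : Aᵀ = A) :
    (pinv A)ᵀ = pinv A := by
  have h := (isMoorePenrose_pinv A).transpose
  rw [hA] at h
  exact h.unique (isMoorePenrose_pinv A)

theorem pinv_mul_mul_pinv {m n : Type*} [Fintype m] [Fintype n] (A : Matrix m n ℝ) :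
    pinv A * A * pinv A = pinv A :=
  (isMoorePenrose_pinv A).self_mul_mul

/-- For symmetric `A`, the identity `A† = A† * A * (A†)ᵀ` exhibits the pseudo-inverse as a
congruence of `A`. This ensures that `lsqrt` is applied where a square root exists, not at its
default value. -/
theorem posSemidef_pinv {n : Type*} [Fintype n] {A : Matrix n n ℝ} (hA : A.PosSemidef) :
    (pinv A).PosSemidef := by
  have h := hA.mul_mul_conjTranspose_same (pinv A)
  have hs : Aᵀ = A := by
    simpa [conjTranspose_eq_transpose_of_trivial] using hA.isHermitian.eq
  rwa [conjTranspose_eq_transpose_of_trivial, pinv_transpose_of_symm hs, pinv_mul_mul_pinv] at h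

/-! ### The posterior of projected observations -/

section Posterior

variable {T D ι : Type*} [Fintype D] [Fintype ι]

/-- The projected observation matrix `Sᵀ * H` of step `k`. -/
def actionObs (o : ObsModel T D) (k : ℕ) : Matrix (Fin (o.numAct k)) D ℝ := (o.S k)ᵀ * o.H k

/-- The covariance of the projected innovation of step `k`, if the state at that time has
covariance `P`. -/
def innovCov (o : ObsModel T D) (k : ℕ) (P : Matrix D D ℝ) :
    Matrix (Fin (o.numAct k)) (Fin (o.numAct k)) ℝ :=
  actionObs o k * P * (actionObs o k)ᵀ + (o.S k)ᵀ * o.noiseCov k * o.S k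

/-- The matrix `W * Wᵀ` of the update of step `k`. -/
def updateGram (o : ObsModel T D) (k : ℕ) (P : Matrix D D ℝ) : Matrix D D ℝ :=
  (actionObs o k)ᵀ * pinv (innovCov o k P) * actionObs o k

/-- The posterior covariance function after `k` steps. -/
def postCov (o : ObsModel T D) (K : T → T → Matrix D D ℝ) : ℕ → T → T → Matrix D D ℝ
  | 0 => K
  | k + 1 => fun t s =>
    let P := postCov o K k (o.time (k + 1)) (o.time (k + 1))
    postCov o K k t s - postCov o K k t (o.time (k + 1)) * updateGram o (k + 1) P *
      postCov o K k (o.time (k + 1)) s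

/-- The weights of the (centred) observations in the posterior mean after `k` steps. The rows of
`E k` pick out the observations of step `k` among all observations. -/
def postWeight (o : ObsModel T D) (K : T → T → Matrix D D ℝ)
    (E : ∀ k, Matrix (Fin (o.dim k)) ι ℝ) : ℕ → T → Matrix D ι ℝ
  | 0 => fun _ => 0
  | k + 1 => fun t =>
    let P := postCov o K k (o.time (k + 1)) (o.time (k + 1))
    postWeight o K E k t + postCov o K k t (o.time (k + 1)) * ((actionObs o (k + 1))ᵀ *
      pinv (innovCov o (k + 1) P) * ((o.S (k + 1))ᵀ * E (k + 1) -
        actionObs o (k + 1) * postWeight o K E k (o.time (k + 1))))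

/-- `Q t` is the covariance of the state at time `t` with all observations, and `R` is the
covariance of the observations, where `E k` picks out the observations of step `k`. -/
structure IsObsCov (o : ObsModel T D) (K : T → T → Matrix D D ℝ)
    (E : ∀ k, Matrix (Fin (o.dim k)) ι ℝ) (Q : T → Matrix D ι ℝ) (R : Matrix ι ι ℝ) : Prop where
  posSemidef : R.PosSemidef
  noise_symm : ∀ k ∈ Set.Icc 1 o.num, (o.noiseCov k)ᵀ = o.noiseCov k
  select_self : ∀ k ∈ Set.Icc 1 o.num, E k * (E k)ᵀ = 1
  select_of_ne : ∀ j ∈ Set.Icc 1 o.num, ∀ k ∈ Set.Icc 1 o.num, j ≠ k → E j * (E k)ᵀ = 0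
  cross : ∀ k ∈ Set.Icc 1 o.num, ∀ t, Q t * (E k)ᵀ = K t (o.time k) * (o.H k)ᵀ
  obs : ∀ k ∈ Set.Icc 1 o.num,
    R * (E k)ᵀ = (Q (o.time k))ᵀ * (o.H k)ᵀ + (E k)ᵀ * o.noiseCov k

variable {o : ObsModel T D} {K : T → T → Matrix D D ℝ} {E : ∀ k, Matrix (Fin (o.dim k)) ι ℝ}
  {Q : T → Matrix D ι ℝ} {R : Matrix ι ι ℝ}

theorem postCov_succ (k : ℕ) (t s : T) :
    postCov o K (k + 1) t s = postCov o K k t s - postCov o K k t (o.time (k + 1)) *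
      updateGram o (k + 1) (postCov o K k (o.time (k + 1)) (o.time (k + 1))) *
      postCov o K k (o.time (k + 1)) s := rfl

omit [Fintype ι] in
theorem postWeight_succ (k : ℕ) (t : T) :
    postWeight o K E (k + 1) t = postWeight o K E k t + postCov o K k t (o.time (k + 1)) *
      ((actionObs o (k + 1))ᵀ *
      pinv (innovCov o (k + 1) (postCov o K k (o.time (k + 1)) (o.time (k + 1)))) *
        ((o.S (k + 1))ᵀ * E (k + 1) -
          actionObs o (k + 1) * postWeight o K E k (o.time (k + 1)))) := rfl

theorem IsObsCov.symm (h : IsObsCov o K E Q R) : Rᵀ = R := by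
  simpa [conjTranspose_eq_transpose_of_trivial] using h.posSemidef.isHermitian.eq

/-- After `j` steps the rows of the weights lie in the span of the rows of `E 1, …, E j`, which are
orthogonal to those of `E k`. Consequently the noise of step `k` is uncorrelated with earlier
prediction errors. -/
theorem IsObsCov.postWeight_mul_select (h : IsObsCov o K E Q R) {k : ℕ} (hk : k ≤ o.num) :
    ∀ j < k, ∀ t, postWeight o K E j t * (E k)ᵀ = 0 := by
  intro j
  induction j with
  | zero => intro _ t; simp [postWeight]
  | succ j ih =>
    intro hj t
    rw [postWeight_succ, Matrix.add_mul, ih (by omega), zero_add, Matrix.mul_assoc,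
      Matrix.mul_assoc _ _ (E k)ᵀ, Matrix.sub_mul, Matrix.mul_assoc _ _ (E k)ᵀ,
      Matrix.mul_assoc _ _ (E k)ᵀ, ih (by omega),
      h.select_of_ne _ ⟨by omega, by omega⟩ k ⟨by omega, by omega⟩ (by omega)]
    simp

/-- The covariance of the prediction errors of the predictions with weights `p` and `q`. -/
def errorCov (K : T → T → Matrix D D ℝ) (Q : T → Matrix D ι ℝ) (R : Matrix ι ι ℝ)
    (p : T → Matrix D ι ℝ) (t s : T) : Matrix D D ℝ :=
  K t s - Q t * (p s)ᵀ - p t * (Q s)ᵀ + p t * R * (p s)ᵀ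

omit [Fintype D] in
theorem errorCov_transpose (hK : ∀ t s, (K t s)ᵀ = K s t) (hR : Rᵀ = R) (p : T → Matrix D ι ℝ)
    (t s : T) : (errorCov K Q R p t s)ᵀ = errorCov K Q R p s t := by
  simp only [errorCov, transpose_add, transpose_sub, transpose_mul, transpose_transpose, hK, hR,
    Matrix.mul_assoc]
  abel

/-- The covariance of the prediction error at time `t` with the innovation of step `k`. -/
theorem IsObsCov.error_innov (h : IsObsCov o K E Q R) {k : ℕ} (hk : k ∈ Set.Icc 1 o.num)
    {p : T → Matrix D ι ℝ} (hp : ∀ t, p t * (E k)ᵀ = 0) (t : T) :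
    (Q t - p t * R) * ((o.S k)ᵀ * E k - actionObs o k * p (o.time k))ᵀ =
      errorCov K Q R p t (o.time k) * (actionObs o k)ᵀ := by
  -- `hp` removes the noise term of `h.obs`: the weights `p` do not touch step `k`.
  have h1 : (Q t - p t * R) * (E k)ᵀ = (K t (o.time k) - p t * (Q (o.time k))ᵀ) * (o.H k)ᵀ := by
    rw [Matrix.sub_mul, h.cross k hk, Matrix.mul_assoc, h.obs k hk, Matrix.mul_add,
      ← Matrix.mul_assoc (p t) (E k)ᵀ, hp, Matrix.zero_mul, add_zero, Matrix.sub_mul,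
      Matrix.mul_assoc]
  rw [transpose_sub, transpose_mul, transpose_transpose, Matrix.mul_sub, ← Matrix.mul_assoc, h1,
    transpose_mul (actionObs o k), ← Matrix.mul_assoc, errorCov, actionObs, transpose_mul,
    transpose_transpose]
  simp only [Matrix.sub_mul, Matrix.add_mul, Matrix.mul_assoc]
  abel

/-- The covariance of the innovation of step `k`. -/
theorem IsObsCov.innov_innov (h : IsObsCov o K E Q R) (hK : ∀ t s, (K t s)ᵀ = K s t) {k : ℕ}
    (hk : k ∈ Set.Icc 1 o.num) {p : T → Matrix D ι ℝ} (hp : ∀ t, p t * (E k)ᵀ = 0) :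
    ((o.S k)ᵀ * E k - actionObs o k * p (o.time k)) * R *
      ((o.S k)ᵀ * E k - actionObs o k * p (o.time k))ᵀ =
      innovCov o k (errorCov K Q R p (o.time k) (o.time k)) := by
  set J := (o.S k)ᵀ * E k - actionObs o k * p (o.time k) with hJ
  have hu := congrArg Matrix.transpose (h.error_innov hk hp (o.time k))
  rw [← hJ, transpose_mul, transpose_mul, transpose_transpose, transpose_transpose,
    errorCov_transpose hK h.symm, transpose_sub, transpose_mul, h.symm] at hu
  -- The innovation contains the step `k` data only through `S k`, so the noise contributes exactly
  -- `Sᵀ * noiseCov * S`.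
  have hE : J * (E k)ᵀ = (o.S k)ᵀ := by
    rw [hJ, Matrix.sub_mul, Matrix.mul_assoc, Matrix.mul_assoc, hp, h.select_self k hk]
    simp
  have hR : R * Jᵀ = ((Q (o.time k))ᵀ - R * (p (o.time k))ᵀ) * (actionObs o k)ᵀ +
      (E k)ᵀ * o.noiseCov k * o.S k := by
    rw [hJ, transpose_sub, transpose_mul, transpose_mul, transpose_transpose, Matrix.mul_sub,
      ← Matrix.mul_assoc, h.obs k hk, actionObs, transpose_mul, transpose_transpose]
    simp only [Matrix.sub_mul, Matrix.add_mul, Matrix.mul_assoc]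
    abel
  rw [Matrix.mul_assoc, hR, Matrix.mul_add, ← Matrix.mul_assoc, hu, innovCov,
    ← Matrix.mul_assoc, ← Matrix.mul_assoc, hE]

theorem innovCov_transpose {k : ℕ} (hn : (o.noiseCov k)ᵀ = o.noiseCov k) {P : Matrix D D ℝ}
    (hP : Pᵀ = P) : (innovCov o k P)ᵀ = innovCov o k P := by
  simp only [innovCov, transpose_add, transpose_mul, transpose_transpose, hn, hP,
    Matrix.mul_assoc]

/-- The recursively defined posterior covariance is the covariance of the prediction errors. -/
theorem IsObsCov.errorCov_postWeight (h : IsObsCov o K E Q R) (hK : ∀ t s, (K t s)ᵀ = K s t)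
    {k : ℕ} (hk : k ≤ o.num) (t s : T) :
    errorCov K Q R (postWeight o K E k) t s = postCov o K k t s := by
  induction k generalizing t s with
  | zero => simp [errorCov, postWeight, postCov]
  | succ k ih =>
    have ih := ih (by omega)
    have hk' : k + 1 ∈ Set.Icc 1 o.num := ⟨by omega, hk⟩
    have hp := h.postWeight_mul_select (K := K) hk k (by omega)
    have hs : ∀ t s, (postCov o K k t s)ᵀ = postCov o K k s t := fun t s => by
      rw [← ih, errorCov_transpose hK h.symm, ih]
    have hu := h.error_innov hk' hp
    have hJ := h.innov_innov hK hk' hp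
    simp only [ih] at hu hJ
    set τ := o.time (k + 1)
    set J := (o.S (k + 1))ᵀ * E (k + 1) - actionObs o (k + 1) * postWeight o K E k τ with hJdef
    set G := innovCov o (k + 1) (postCov o K k τ τ) with hG
    have hGs : (pinv G)ᵀ = pinv G :=
      pinv_transpose_of_symm (innovCov_transpose (h.noise_symm _ hk') (hs _ _))
    have hu' : ∀ t, J * ((Q t)ᵀ - R * (postWeight o K E k t)ᵀ) =
        actionObs o (k + 1) * postCov o K k τ t := fun t => by
      have := congrArg Matrix.transpose (hu t)
      rwa [transpose_mul, transpose_transpose, transpose_mul, transpose_transpose, hs,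
        transpose_sub, transpose_mul, h.symm] at this
    have e1 : ∀ t, postWeight o K E (k + 1) t = postWeight o K E k t +
        postCov o K k t τ * (actionObs o (k + 1))ᵀ * pinv G * J := fun t => by
      rw [postWeight_succ]
      simp only [Matrix.mul_assoc]
      rfl
    set p := postWeight o K E k
    -- The new weights are the old ones plus a gain times the innovation weights `J`. Expanding for
    -- arbitrary gains leaves only covariances already known from `hu`, `hu'`, `hJ` and `ih`.
    have e2 : ∀ L M : Matrix D (Fin (o.numAct (k + 1))) ℝ,
        K t s - Q t * (p s + M * J)ᵀ - (p t + L * J) * (Q s)ᵀ +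
          (p t + L * J) * R * (p s + M * J)ᵀ =
        errorCov K Q R p t s - (Q t - p t * R) * Jᵀ * Mᵀ - L * (J * ((Q s)ᵀ - R * (p s)ᵀ)) +
          L * (J * R * Jᵀ) * Mᵀ := fun L M => by
      simp only [errorCov, transpose_add, transpose_mul, Matrix.mul_sub, Matrix.sub_mul,
        Matrix.mul_add, Matrix.add_mul, Matrix.mul_assoc]
      abel
    rw [errorCov, e1, e1, e2, hu, hu', hJ, ih, postCov_succ, updateGram, ← hG]
    simp only [transpose_mul, transpose_transpose, hGs, hs]
    -- By `G† * G * G† = G†` the quadratic term cancels one of the two equal linear terms. No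
    -- invertibility of `G` is needed.
    have e3 := pinv_mul_mul_pinv G
    have e4 : postCov o K k t τ * (actionObs o (k + 1))ᵀ * pinv G * G *
        (pinv G * (actionObs o (k + 1) * postCov o K k τ s)) =
        postCov o K k t τ * (actionObs o (k + 1))ᵀ * pinv G *
          (actionObs o (k + 1) * postCov o K k τ s) := by
      conv_rhs => rw [← e3]
      simp only [Matrix.mul_assoc]
    rw [e4]
    simp only [Matrix.mul_assoc]
    abel

theorem IsObsCov.postCov_transpose (h : IsObsCov o K E Q R) (hK : ∀ t s, (K t s)ᵀ = K s t)
    {k : ℕ} (hk : k ≤ o.num) (t s : T) : (postCov o K k t s)ᵀ = postCov o K k s t := by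
  rw [← h.errorCov_postWeight hK hk, errorCov_transpose hK h.symm, h.errorCov_postWeight hK hk]

theorem IsObsCov.posSemidef_innovCov (h : IsObsCov o K E Q R) (hK : ∀ t s, (K t s)ᵀ = K s t)
    {k : ℕ} (hk : k + 1 ≤ o.num) :
    (innovCov o (k + 1) (postCov o K k (o.time (k + 1)) (o.time (k + 1)))).PosSemidef := by
  have hp := h.postWeight_mul_select (K := K) hk k (by omega)
  have hJ := h.innov_innov hK ⟨by omega, hk⟩ hp
  rw [h.errorCov_postWeight hK (by omega)] at hJ
  rw [← hJ, ← conjTranspose_eq_transpose_of_trivial (_ - _)]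
  exact h.posSemidef.mul_mul_conjTranspose_same _

end Posterior

theorem Columns.gram_lmul {D : Type*} [Fintype D] (A : Matrix D D ℝ) (L : Columns D) :
    (L.lmul A).gram = A * L.gram * Aᵀ := by
  change (A * L.mat) * (A * L.mat)ᵀ = A * (L.mat * L.matᵀ) * Aᵀ
  rw [transpose_mul]
  simp only [Matrix.mul_assoc]

/-! ### The filter and the smoother compute the posterior -/

section Recursions

variable {T D ι : Type*} [LinearOrder T] [Fintype D] [Fintype ι]

/-- `K` is the covariance function of a Gauss–Markov process with the prior model `p`. -/
structure IsMarkovCov (p : PriorModel T D) (K : T → T → Matrix D D ℝ) : Prop where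
  diag : ∀ t, K t t = p.cov t
  symm : ∀ t s, (K t s)ᵀ = K s t
  trans : ∀ s r t, s ≤ r → r ≤ t → K t s = p.trans t r * K r s
  offset : ∀ s t, s ≤ t → p.mean t = p.trans t s *ᵥ p.mean s + p.offset t s

/-- The posterior mean function after `k` steps, for the centred observations `e`. -/
def postMean (p : PriorModel T D) (o : ObsModel T D) (K : T → T → Matrix D D ℝ)
    (E : ∀ k, Matrix (Fin (o.dim k)) ι ℝ) (e : ι → ℝ) (k : ℕ) (t : T) : D → ℝ :=
  p.mean t + postWeight o K E k t *ᵥ e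

variable {p : PriorModel T D} {o : ObsModel T D} {K : T → T → Matrix D D ℝ}
  {E : ∀ k, Matrix (Fin (o.dim k)) ι ℝ} {Q : T → Matrix D ι ℝ} {R : Matrix ι ι ℝ}

-- Each conditioning step subtracts a product whose left factor is the earlier posterior covariance
-- of time `t` with an observation time not after `r`. The induction hypothesis, for general `s`,
-- thus pulls `p.trans t r` out of both terms.
omit [Fintype ι] in
theorem IsMarkovCov.postCov_trans (hK : IsMarkovCov p K) {k : ℕ} {s r t : T}
    (hk : ∀ j ∈ Set.Icc 1 k, o.time j ≤ r) (hsr : s ≤ r) (hrt : r ≤ t) :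
    postCov o K k t s = p.trans t r * postCov o K k r s := by
  induction k generalizing s with
  | zero => exact hK.trans s r t hsr hrt
  | succ k ih =>
    have ih := fun s => @ih s fun j hj => hk j ⟨hj.1, hj.2.trans k.le_succ⟩
    rw [postCov_succ, postCov_succ, ih s hsr, ih _ (hk _ ⟨by omega, le_rfl⟩)]
    simp only [Matrix.mul_sub, Matrix.mul_assoc]

omit [Fintype ι] in
theorem IsMarkovCov.postWeight_trans (hK : IsMarkovCov p K) {k : ℕ} {r t : T}
    (hk : ∀ j ∈ Set.Icc 1 k, o.time j ≤ r) (hrt : r ≤ t) :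
    postWeight o K E k t = p.trans t r * postWeight o K E k r := by
  induction k with
  | zero => simp [postWeight]
  | succ k ih =>
    have hk' : ∀ j ∈ Set.Icc 1 k, o.time j ≤ r := fun j hj => hk j ⟨hj.1, hj.2.trans k.le_succ⟩
    rw [postWeight_succ, postWeight_succ, ih hk',
      hK.postCov_trans hk' (hk _ ⟨by omega, le_rfl⟩) hrt]
    simp only [Matrix.mul_add, Matrix.mul_assoc]

theorem IsMarkovCov.postMean_trans (hK : IsMarkovCov p K) {k : ℕ} {r t : T}
    (hk : ∀ j ∈ Set.Icc 1 k, o.time j ≤ r) (hrt : r ≤ t) (e : ι → ℝ) :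
    postMean p o K E e k t = p.trans t r *ᵥ postMean p o K E e k r + p.offset t r := by
  rw [postMean, postMean, hK.postWeight_trans hk hrt, hK.offset r t hrt, mulVec_add,
    mulVec_mulVec]
  abel

/-- The downdate is a sum of terms `postCov t τ * U * postCov τ t`, in which the transition factors
out on both sides. The covariance itself would also pick up process noise; this is why the filter
propagates `M` by `M⁻ = A * M` and recovers `P⁻` from the prior covariance. -/
theorem IsMarkovCov.sub_postCov_trans (hK : IsMarkovCov p K) (h : IsObsCov o K E Q R) {k : ℕ}
    (hkn : k ≤ o.num) {r t : T} (hk : ∀ j ∈ Set.Icc 1 k, o.time j ≤ r) (hrt : r ≤ t) :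
    K t t - postCov o K k t t = p.trans t r * (K r r - postCov o K k r r) * (p.trans t r)ᵀ := by
  induction k with
  | zero => simp [postCov]
  | succ k ih =>
    have hk' : ∀ j ∈ Set.Icc 1 k, o.time j ≤ r := fun j hj => hk j ⟨hj.1, hj.2.trans k.le_succ⟩
    have h1 := hK.postCov_trans hk' (hk (k + 1) ⟨by omega, le_rfl⟩) hrt
    have h2 := congrArg Matrix.transpose h1
    rw [transpose_mul, h.postCov_transpose hK.symm (by omega),
      h.postCov_transpose hK.symm (by omega)] at h2
    rw [postCov_succ, postCov_succ, sub_sub_eq_add_sub, add_sub_right_comm, ih (by omega) hk', h1,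
      h2, sub_sub_eq_add_sub, add_sub_right_comm]
    simp only [Matrix.mul_add, Matrix.add_mul, Matrix.mul_assoc]

/-- The vector `w` of the update of step `k`, from the predictive covariance and mean. -/
def updateVec (o : ObsModel T D) (k : ℕ) (P : Matrix D D ℝ) (m : D → ℝ)
    (y : Fin (o.dim k) → ℝ) : D → ℝ :=
  (actionObs o k)ᵀ *ᵥ (pinv (innovCov o k P) *ᵥ ((o.S k)ᵀ *ᵥ y - actionObs o k *ᵥ m))

variable {e : ι → ℝ} {y : ∀ k, Fin (o.dim k) → ℝ}

-- `he` says that `e` collects the centred data, so the prior mean cancels in the innovation and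
-- leaves the data minus the predicted observation.
omit [LinearOrder T] in
theorem postMean_succ {k : ℕ}
    (he : E (k + 1) *ᵥ e = y (k + 1) - o.H (k + 1) *ᵥ p.mean (o.time (k + 1))) (t : T) :
    postMean p o K E e (k + 1) t = postMean p o K E e k t + postCov o K k t (o.time (k + 1)) *ᵥ
      updateVec o (k + 1) (postCov o K k (o.time (k + 1)) (o.time (k + 1)))
        (postMean p o K E e k (o.time (k + 1))) (y (k + 1)) := by
  simp only [postMean, postWeight_succ, updateVec, add_mulVec, sub_mulVec, ← mulVec_mulVec, he,
    mulVec_add, mulVec_sub, actionObs]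
  abel

/-- Prediction is the Markov property of the posterior, and update is one conditioning step. The
last part is stated for `k = l + 1` because step `0` has no update. -/
theorem cakf_spec (hK : IsMarkovCov p K) (h : IsObsCov o K E Q R)
    (hτ : ∀ j k, j ≤ k → k ≤ o.num → o.time j ≤ o.time k)
    (he : ∀ k ∈ Set.Icc 1 o.num, E k *ᵥ e = y k - o.H k *ᵥ p.mean (o.time k)) {k : ℕ}
    (hk : k ≤ o.num) :
    (cakf p o y k).mean = postMean p o K E e k (o.time k) ∧
      cakfCov p o y k = postCov o K k (o.time k) (o.time k) ∧
      ∀ l, k = l + 1 → cakfPredCov p o y k = postCov o K l (o.time k) (o.time k) ∧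
        (cakf p o y k).W.gram = updateGram o k (postCov o K l (o.time k) (o.time k)) ∧
        (cakf p o y k).w = updateVec o k (postCov o K l (o.time k) (o.time k))
          (postMean p o K E e l (o.time k)) (y k) := by
  induction k with
  | zero =>
    refine ⟨by simp [cakf, postMean, postWeight], ?_, fun l hl => by omega⟩
    rw [cakfCov, cakf, Columns.gram_empty, sub_zero, ← hK.diag, postCov]
  | succ k ih =>
    obtain ⟨ihm, ihc, -⟩ := ih (by omega)
    have hle := hτ k (k + 1) (by omega) hk
    have hj : ∀ j ∈ Set.Icc 1 k, o.time j ≤ o.time k := fun j hj => hτ j k hj.2 (by omega)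
    have hm : (cakf p o y (k + 1)).predMean = postMean p o K E e k (o.time (k + 1)) := by
      rw [hK.postMean_trans hj hle, ← ihm]
      rfl
    have hP : cakfPredCov p o y (k + 1) =
        postCov o K k (o.time (k + 1)) (o.time (k + 1)) := by
      have h1 := hK.sub_postCov_trans h (by omega) hj hle
      have h2 : (cakf p o y k).down.gram = K (o.time k) (o.time k) -
          postCov o K k (o.time k) (o.time k) := by
        rw [← ihc, cakfCov, hK.diag, sub_sub_cancel]
      rw [← h2, ← Columns.gram_lmul] at h1
      rw [cakfPredCov, ← hK.diag, ← sub_sub_cancel (K _ _) (postCov o K k _ _), h1]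
      rfl
    have hW : (cakf p o y (k + 1)).W.gram =
        updateGram o (k + 1) (postCov o K k (o.time (k + 1)) (o.time (k + 1))) := by
      rw [← hP]
      -- The innovation covariance is positive semidefinite, hence so is its pseudo-inverse, and
      -- `lsqrt` is a true square root.
      have hV := lsqrt_mul_transpose (posSemidef_pinv (h.posSemidef_innovCov hK.symm hk))
      rw [← hP] at hV
      change ((actionObs o (k + 1))ᵀ * lsqrt (pinv (innovCov o (k + 1) (cakfPredCov p o y (k + 1)))))
        * ((actionObs o (k + 1))ᵀ *
          lsqrt (pinv (innovCov o (k + 1) (cakfPredCov p o y (k + 1)))))ᵀ = _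
      rw [transpose_mul, transpose_transpose, updateGram]
      conv_rhs => rw [← hV]
      simp only [Matrix.mul_assoc]
    have hw : (cakf p o y (k + 1)).w =
        updateVec o (k + 1) (postCov o K k (o.time (k + 1)) (o.time (k + 1)))
          (postMean p o K E e k (o.time (k + 1))) (y (k + 1)) := by
      rw [← hP, ← hm]
      rfl
    refine ⟨?_, ?_, fun l hl => ?_⟩
    · rw [postMean_succ (he _ ⟨by omega, hk⟩), ← hw, ← hP, ← hm]
      rfl
    · have hd : (cakf p o y (k + 1)).down.gram = (cakf p o y (k + 1)).predDown.gram +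
          cakfPredCov p o y (k + 1) * (cakf p o y (k + 1)).W.gram *
            (cakfPredCov p o y (k + 1))ᵀ := by
        rw [← Columns.gram_lmul, ← Columns.gram_append]
        rfl
      rw [cakfCov, hd, ← sub_sub]
      change cakfPredCov p o y (k + 1) - _ = _
      rw [hP, hW, h.postCov_transpose hK.symm (by omega), postCov_succ]
    · obtain rfl : k = l := by omega
      exact ⟨hP, hW, hw⟩

variable [DecidableEq D]

omit [LinearOrder T] in
theorem smootherPair_of_lt {k : ℕ} (hk : k < o.num) :
    smootherPair p o y k =
      (let next := smootherPair p o y (k + 1)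
       let B : Matrix D D ℝ := (1 - (cakf p o y k).W.gram * cakfPredCov p o y k) *
        (p.trans (o.time (k + 1)) (o.time k))ᵀ
       ((cakf p o y k).w + B *ᵥ next.1, (cakf p o y k).W.append (next.2.lmul B))) := by
  obtain ⟨j, hj⟩ : ∃ j, o.num - k = j + 1 := ⟨o.num - k - 1, by omega⟩
  have hj' : o.num - (k + 1) = j := by omega
  rw [smootherPair, hj, smootherPair, hj', smootherPairFrom]

/-- The pair at step `k + 1` summarises all data from that step on. Their effect on times up to
`o.time (k + 1)` passes through the state at that time, hence through `postCov o K k t (o.time (k +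
1))`. The proof runs backwards, by induction on the number of remaining steps. -/
theorem smootherPair_spec (hK : IsMarkovCov p K) (h : IsObsCov o K E Q R)
    (hτ : ∀ j k, j ≤ k → k ≤ o.num → o.time j ≤ o.time k)
    (he : ∀ k ∈ Set.Icc 1 o.num, E k *ᵥ e = y k - o.H k *ᵥ p.mean (o.time k)) {k : ℕ}
    (hk : k + 1 ≤ o.num) {t s : T} (ht : t ≤ o.time (k + 1)) (hs : s ≤ o.time (k + 1)) :
    postMean p o K E e o.num t = postMean p o K E e k t +
        postCov o K k t (o.time (k + 1)) *ᵥ (smootherPair p o y (k + 1)).1 ∧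
      postCov o K o.num t s = postCov o K k t s - postCov o K k t (o.time (k + 1)) *
        (smootherPair p o y (k + 1)).2.gram * postCov o K k (o.time (k + 1)) s := by
  induction hd : o.num - (k + 1) generalizing k t s with
  | zero =>
    obtain ⟨-, -, hsp⟩ := cakf_spec (y := y) hK h hτ he hk
    obtain ⟨-, hW, hw⟩ := hsp k rfl
    have hpair : smootherPair p o y (k + 1) = ((cakf p o y (k + 1)).w, (cakf p o y (k + 1)).W) := by
      rw [smootherPair, hd, smootherPairFrom]
    have hn : o.num = k + 1 := by omega
    rw [hpair, hW, hw, hn, ← postMean_succ (he _ ⟨by omega, hk⟩), ← postCov_succ]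
    exact ⟨rfl, rfl⟩
  | succ d ih =>
    obtain ⟨-, -, hsp⟩ := cakf_spec (y := y) hK h hτ he hk
    obtain ⟨hP, hW, hw⟩ := hsp k rfl
    have hle := hτ (k + 1) (k + 2) (by omega) (by omega)
    obtain ⟨ihm, ihc⟩ := @ih (k + 1) (by omega) t s (ht.trans hle) (hs.trans hle) (by omega)
    have hsymm : ∀ i ≤ k + 1, ∀ t s, (postCov o K i t s)ᵀ = postCov o K i s t :=
      fun i hi => h.postCov_transpose hK.symm (by omega)
    set B : Matrix D D ℝ := (1 - (cakf p o y (k + 1)).W.gram * cakfPredCov p o y (k + 1)) *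
        (p.trans (o.time (k + 2)) (o.time (k + 1)))ᵀ with hB
    -- `Bᵀ = A * (1 - P⁻ * W * Wᵀ)` conditions on step `k + 1` and then moves to the next
    -- observation time.
    have hs1 : ∀ s ≤ o.time (k + 1), postCov o K (k + 1) (o.time (k + 2)) s =
        Bᵀ * postCov o K k (o.time (k + 1)) s := fun s hs => by
      rw [hK.postCov_trans (fun j hj => hτ j (k + 1) hj.2 hk) hs hle, postCov_succ, hB, hP, hW]
      have hU : (updateGram o (k + 1) (postCov o K k (o.time (k + 1)) (o.time (k + 1))))ᵀ =
          updateGram o (k + 1) (postCov o K k (o.time (k + 1)) (o.time (k + 1))) := by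
        rw [← hW, Columns.gram, transpose_mul, transpose_transpose]
      rw [transpose_mul, transpose_transpose, transpose_sub, transpose_mul, transpose_one, hU,
        hsymm k (by omega)]
      simp only [Matrix.mul_sub, Matrix.sub_mul, Matrix.mul_assoc, Matrix.one_mul]
    have ht1 : ∀ t ≤ o.time (k + 1), postCov o K (k + 1) t (o.time (k + 2)) =
        postCov o K k t (o.time (k + 1)) * B := fun t ht => by
      have := congrArg Matrix.transpose (hs1 t ht)
      rwa [hsymm _ le_rfl, transpose_mul, transpose_transpose, hsymm k (by omega)] at this
    have hpair : smootherPair p o y (k + 1) =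
        ((cakf p o y (k + 1)).w + B *ᵥ (smootherPair p o y (k + 2)).1,
          (cakf p o y (k + 1)).W.append ((smootherPair p o y (k + 2)).2.lmul B)) :=
      smootherPair_of_lt (by omega)
    clear_value B
    rw [hpair]
    constructor
    · rw [ihm, ht1 t ht, postMean_succ (he _ ⟨by omega, hk⟩), ← hw, add_assoc, mulVec_add,
        mulVec_mulVec]
    · rw [ihc, ht1 t ht, hs1 s hs, postCov_succ, ← hW, Columns.gram_append, Columns.gram_lmul]
      simp only [Matrix.mul_add, Matrix.add_mul, Matrix.mul_assoc]
      rw [sub_sub]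

omit [DecidableEq D] in
theorem cakfAt_spec (hK : IsMarkovCov p K) (h : IsObsCov o K E Q R)
    (hτ : ∀ j k, j ≤ k → k ≤ o.num → o.time j ≤ o.time k)
    (he : ∀ k ∈ Set.Icc 1 o.num, E k *ᵥ e = y k - o.H k *ᵥ p.mean (o.time k)) (t : T) :
    (cakfAt p o y t).1 = postMean p o K E e (lastStep o t) t ∧
      p.cov t - (cakfAt p o y t).2.gram = postCov o K (lastStep o t) t t := by
  set k := lastStep o t with hk
  have hkn : k ≤ o.num := Nat.findGreatest_le _
  obtain ⟨hm, hP, -⟩ := cakf_spec (y := y) hK h hτ he hkn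
  rw [cakfAt, ← hk]
  by_cases ht : t = o.time k
  · simp only [ht, if_true]
    exact ⟨hm, hP⟩
  simp only [ht, if_false]
  by_cases hk1 : k < 1
  · have h0 : k = 0 := by omega
    rw [h0]
    simp [postMean, postWeight, postCov, Columns.gram_empty, hK.diag]
  · simp only [hk1, if_false]
    -- The value `0` of `Nat.findGreatest` is a default that says nothing about `o.time 0`. Only a
    -- nonzero index gives this inequality; at index `0` the posterior is the prior.
    have hkt : o.time k ≤ t :=
      Nat.findGreatest_of_ne_zero (P := fun k => o.time k ≤ t) rfl (by omega)
    have hj : ∀ j ∈ Set.Icc 1 k, o.time j ≤ o.time k := fun j hj => hτ j k hj.2 hkn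
    refine ⟨by rw [hK.postMean_trans hj hkt, hm], ?_⟩
    have h1 := hK.sub_postCov_trans h hkn hj hkt
    rw [Columns.gram_lmul, ← hK.diag, ← sub_sub_cancel (K t t) (postCov o K k t t), h1, ← hP,
      cakfCov, hK.diag, hK.diag, sub_sub_cancel]

theorem caksAt_spec (hK : IsMarkovCov p K) (h : IsObsCov o K E Q R)
    (hτ : ∀ j k, j ≤ k → k ≤ o.num → o.time j ≤ o.time k)
    (he : ∀ k ∈ Set.Icc 1 o.num, E k *ᵥ e = y k - o.H k *ᵥ p.mean (o.time k)) (t : T) :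
    smootherMean p o y t = postMean p o K E e o.num t ∧
      smootherCov p o y t = postCov o K o.num t t := by
  obtain ⟨hm, hP⟩ := cakfAt_spec (y := y) hK h hτ he t
  set k := lastStep o t with hk
  have hkn : k ≤ o.num := Nat.findGreatest_le _
  -- At `t = o.time k` the interpolated filter is the filter itself, so the grid and off-grid
  -- formulas of the smoother coincide.
  have key : caksAt p o y t = if k < o.num then
      let B : Matrix D D ℝ :=
        (p.cov t - (cakfAt p o y t).2.gram) * (p.trans (o.time (k + 1)) t)ᵀ
      ((cakfAt p o y t).1 + B *ᵥ (smootherPair p o y (k + 1)).1,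
        (cakfAt p o y t).2.append ((smootherPair p o y (k + 1)).2.lmul B))
      else cakfAt p o y t := by
    rw [caksAt, ← hk]
    by_cases ht : t = o.time k
    · have hf : cakfAt p o y t = ((cakf p o y k).mean, (cakf p o y k).down) := by
        rw [cakfAt, ← hk]
        simp only [ht, if_true]
      rw [hf]
      simp only [← ht, if_true, caksStep, cakfCov]
    · simp only [ht, if_false]
  rw [smootherMean, smootherCov, key]
  by_cases hlt : k < o.num
  · have htk : t < o.time (k + 1) := by
      have := Nat.findGreatest_is_greatest (P := fun k => o.time k ≤ t) (n := o.num)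
        (k := k + 1) (by rw [lastStep] at hk; omega) hlt
      exact not_le.1 this
    have hj : ∀ j ∈ Set.Icc 1 k, o.time j ≤ t := fun j hj => by
      have hkt : o.time k ≤ t := Nat.findGreatest_of_ne_zero (P := fun k => o.time k ≤ t) hk.symm
        (by have := hj.1.trans hj.2; omega)
      exact (hτ j k hj.2 hkn).trans hkt
    obtain ⟨hsm, hsc⟩ := smootherPair_spec (y := y) hK h hτ he hlt htk.le htk.le
    -- Taking `s = t` and transposing gives `postCov k t (o.time (k + 1)) = P(t) * Aᵀ`, the
    -- smoother's gain.
    have hst := hK.postCov_trans hj le_rfl htk.le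
    have hts := congrArg Matrix.transpose hst
    rw [transpose_mul, h.postCov_transpose hK.symm hkn, h.postCov_transpose hK.symm hkn] at hts
    simp only [hlt, if_true]
    rw [hP, hm, ← hts, Columns.gram_append, Columns.gram_lmul, h.postCov_transpose hK.symm hkn,
      ← sub_sub, hP, hsm, hsc]
    exact ⟨rfl, rfl⟩
  · have hn : k = o.num := by omega
    simp only [hlt, if_false]
    rw [hm, hP, hn]
    exact ⟨rfl, rfl⟩

end Recursions

/-! ### Moments of Gauss–Markov processes -/

section Moments

variable {T Ω : Type*} [MeasurableSpace Ω] {d : ℕ} {f : T → Ω → EuclideanSpace ℝ (Fin d)}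
  {P : Measure Ω} {m : T → Fin d → ℝ} {C : T → T → Matrix (Fin d) (Fin d) ℝ}
  {A : T → T → Matrix (Fin d) (Fin d) ℝ} {b : T → T → Fin d → ℝ}
  {Q : T → T → Matrix (Fin d) (Fin d) ℝ}

theorem IsGP.memLp (hf : IsGP f m C P) (t : T) (a : Fin d) : MemLp (fun ω => f t ω a) 2 P := by
  have h := (hf.gaussian.hasGaussianLaw_eval t).memLp_two
  exact (EuclideanSpace.proj (𝕜 := ℝ) a).comp_memLp' h

theorem IsGP.integrable [IsProbabilityMeasure P] (hf : IsGP f m C P) (t : T) (a : Fin d) :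
    Integrable (fun ω => f t ω a) P :=
  (hf.memLp t a).integrable (by norm_num)

theorem IsGP.cov_transpose (hf : IsGP f m C P) (t s : T) : (C t s)ᵀ = C s t := by
  ext a c
  rw [transpose_apply, ← hf.cov_eq, ← hf.cov_eq, covariance_comm]

variable [LinearOrder T]

/-- The joint law of the past and `f t` disintegrates along the transition kernel, whose mean is `A
f(s) + b`. The function `g` may see the whole past, which is what covariances with times before `s`
require. -/
theorem IsGaussMarkov.integral_mul [IsProbabilityMeasure P] (h : IsGaussMarkov f P A b Q)
    {s t : T} (hst : s ≤ t) {g : (Set.Iic s → EuclideanSpace ℝ (Fin d)) → ℝ}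
    (hg : Measurable g) (a : Fin d)
    (hi : Integrable (fun ω => g (fun r : Set.Iic s => f r ω) * f t ω a) P) :
    ∫ ω, g (fun r : Set.Iic s => f r ω) * f t ω a ∂P =
      ∫ ω, g (fun r : Set.Iic s => f r ω) * (A t s *ᵥ (f s ω).ofLp + b t s) a ∂P := by
  have hl := h.transition s t hst
  set X : Ω → Set.Iic s → EuclideanSpace ℝ (Fin d) := fun ω r => f r ω
  have hX : AEMeasurable X P := hl.aemeasurable_fst
  let F : (Set.Iic s → EuclideanSpace ℝ (Fin d)) × EuclideanSpace ℝ (Fin d) → ℝ :=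
    fun q => g q.1 * q.2 a
  have hF : Measurable F := by fun_prop
  have : IsProbabilityMeasure (P.map X) := Measure.isProbabilityMeasure_map hX
  have hFi : Integrable F (P.map X ⊗ₘ gaussianTransition (A t s) (b t s) (Q t s) s) := by
    rw [← hl.map_eq, integrable_map_measure hF.aestronglyMeasurable hl.aemeasurable]
    exact hi
  have hinner : ∀ x : Set.Iic s → EuclideanSpace ℝ (Fin d),
      ∫ v, F (x, v) ∂(gaussianTransition (A t s) (b t s) (Q t s) s x) =
        g x * (A t s *ᵥ (x ⟨s, le_refl s⟩).ofLp + b t s) a := fun x => by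
    simp only [F, integral_const_mul]
    congr 1
    have h1 := (EuclideanSpace.proj (𝕜 := ℝ) a).integral_comp_comm
      (IsGaussian.integrable_id (μ := multivariateGaussian
        (WithLp.toLp 2 (A t s *ᵥ (x ⟨s, le_refl s⟩).ofLp + b t s)) (Q t s)))
    simp only [id, integral_id_multivariateGaussian] at h1
    exact h1
  calc ∫ ω, g (X ω) * f t ω a ∂P
      = ∫ q, F q ∂(P.map (fun ω => (X ω, f t ω))) := by
        rw [integral_map hl.aemeasurable hF.aestronglyMeasurable]
    _ = ∫ x, g x * (A t s *ᵥ (x ⟨s, le_refl s⟩).ofLp + b t s) a ∂(P.map X) := by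
        rw [hl.map_eq, Measure.integral_compProd hFi]
        exact integral_congr_ae (.of_forall hinner)
    _ = _ := by
        rw [integral_map hX]
        refine Measurable.aestronglyMeasurable (hg.mul ?_)
        have : Continuous fun v : EuclideanSpace ℝ (Fin d) =>
          (A t s *ᵥ v.ofLp + b t s) a := by
            simp only [Pi.add_apply, mulVec, dotProduct]
            fun_prop
        exact this.measurable.comp (measurable_pi_apply _)

theorem IsGaussMarkov.mean_trans [IsProbabilityMeasure P] (h : IsGaussMarkov f P A b Q)
    (hf : IsGP f m C P) {s t : T} (hst : s ≤ t) : m t = A t s *ᵥ m s + b t s := by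
  ext a
  have h1 := h.integral_mul hst (g := fun _ => 1) measurable_const a
    (by simpa using hf.integrable t a)
  simp only [one_mul, hf.mean_eq, Pi.add_apply, mulVec, dotProduct] at h1
  rw [h1, integral_add (integrable_finsetSum _ fun c _ => (hf.integrable s c).const_mul _)
    (integrable_const _), integral_finsetSum _ fun c _ => (hf.integrable s c).const_mul _]
  simp [integral_const_mul, hf.mean_eq, mulVec, dotProduct]

/-- Testing the transition against `1` and against a coordinate of `f s` shows that `f t` may be
replaced by `A f(r) + b` in its covariance with `f s`. -/
theorem IsGaussMarkov.cov_trans [IsProbabilityMeasure P] (h : IsGaussMarkov f P A b Q)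
    (hf : IsGP f m C P) {s r t : T} (hsr : s ≤ r) (hrt : r ≤ t) :
    C t s = A t r * C r s := by
  ext a c
  have hY : MemLp (fun ω => (A t r *ᵥ (f r ω).ofLp + b t r) a) 2 P := by
    simp only [Pi.add_apply, mulVec, dotProduct]
    exact (memLp_finsetSum _ fun c _ => (hf.memLp r c).const_mul _).add (memLp_const _)
  have h1 := h.integral_mul hrt (g := fun _ => 1) measurable_const a
    (by simpa using hf.integrable t a)
  have h2 := h.integral_mul hrt (g := fun x => x ⟨s, hsr⟩ c) (by fun_prop) a
    ((hf.memLp s c).integrable_mul (hf.memLp t a))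
  simp only [one_mul] at h1
  rw [← hf.cov_eq, covariance_comm, covariance_eq_sub (hf.memLp s c) (hf.memLp t a), h1]
  simp only [Pi.mul_apply]
  rw [h2]
  have h3 := covariance_eq_sub (hf.memLp s c) hY
  simp only [Pi.mul_apply] at h3
  rw [← h3, covariance_comm]
  simp only [Pi.add_apply, mulVec, dotProduct]
  rw [covariance_add_const_left
      (integrable_finsetSum _ fun c _ => (hf.integrable r c).const_mul _),
    covariance_fun_sum_left (fun c => (hf.memLp r c).const_mul _) (hf.memLp s c)]
  simp [covariance_const_mul_left, hf.cov_eq, Matrix.mul_apply]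

end Moments

/-! ### The state-space form on a spatial grid -/

/-- The covariance function of the state-space form of a separable process on a grid. -/
def gridCov {T X : Type*} {d n : ℕ} (Ct : T → T → Matrix (Fin d) (Fin d) ℝ) (Cx : X → X → ℝ)
    (grid : Fin n → X) (t s : T) : Matrix (Fin d × Fin n) (Fin d × Fin n) ℝ :=
  Matrix.kronecker (Ct t s) (Matrix.of fun i j => Cx (grid i) (grid j))

theorem IsSTSGMP.isMarkovCov {T X Ω Ω' : Type*} [LinearOrder T] [MeasurableSpace Ω]
    [MeasurableSpace Ω'] {d n : ℕ} {f : T × X → Ω → EuclideanSpace ℝ (Fin d)} {P : Measure Ω}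
    {ft : T → Ω' → EuclideanSpace ℝ (Fin d)} {P' : Measure Ω'} [IsProbabilityMeasure P']
    {μt : T → Fin d → ℝ} {μx : X → ℝ} {Ct : T → T → Matrix (Fin d) (Fin d) ℝ} {Cx : X → X → ℝ}
    {A : T → T → Matrix (Fin d) (Fin d) ℝ} {b : T → T → Fin d → ℝ}
    {Q : T → T → Matrix (Fin d) (Fin d) ℝ} (hf : IsSTSGMP f P ft P' μt μx Ct Cx A b Q)
    (grid : Fin n → X) :
    IsMarkovCov (gridPrior μt μx Ct Cx A b grid) (gridCov Ct Cx grid) where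
  diag _ := rfl
  symm t s := by
    ext i j
    -- Symmetry is taken from the full process: `Cx` alone need not be symmetric when `Ct` vanishes.
    have := congrFun (congrFun
      (hf.separable.cov_transpose (t, grid j.2) (s, grid i.2)) i.1) j.1
    simp only [sepCov, transpose_apply, Matrix.smul_apply, smul_eq_mul] at this
    simp only [gridCov, transpose_apply, kronecker, kroneckerMap_apply, of_apply]
    linarith
  trans s r t hsr hrt := by
    rw [gridCov, hf.markov.cov_trans hf.temporal hsr hrt]
    -- Mixed-product rule: `(A ⊗ 1) * (Ct ⊗ Cx) = (A * Ct) ⊗ Cx`.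
    refine Eq.trans ?_ (mul_kronecker_mul _ _ _ _)
    rw [Matrix.one_mul]
    rfl
  offset s t hst := by
    ext c
    have := congrFun (hf.markov.mean_trans hf.temporal hst) c.1
    simp only [gridPrior]
    simp only [this, Pi.add_apply, mulVec, dotProduct, kronecker, kroneckerMap_apply,
      Fintype.sum_prod_type, Matrix.one_apply]
    simp [add_mul, Finset.sum_mul, mul_assoc]

/-- The operator norm of the functional `⟪h, ·⟫` as a supremum over nonzero vectors. -/
theorem iSup_abs_inner_div_norm {H : Type*} [NormedAddCommGroup H] [InnerProductSpace ℝ H]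
    (h : H) :
    (⨆ g : {g : H // g ≠ 0}, ENNReal.ofReal (|inner ℝ h g.1| / ‖g.1‖)) = ENNReal.ofReal ‖h‖ := by
  apply le_antisymm
  · refine iSup_le fun g => ENNReal.ofReal_le_ofReal ?_
    rw [div_le_iff₀ (norm_pos_iff.2 g.2)]
    exact abs_real_inner_le_norm h g
  · by_cases h0 : h = 0
    · simp [h0]
    · refine le_iSup_of_le ⟨h, h0⟩ (ENNReal.ofReal_le_ofReal (le_of_eq ?_))
      have := norm_ne_zero_iff.2 h0
      rw [real_inner_self_eq_norm_sq, abs_of_nonneg (sq_nonneg _)]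
      field_simp

/-! ### Training data as one stacked observation vector -/

/-- The indices `(k, i)` of the training points, where `1 ≤ k ≤ nt` and `i < N k`. -/
abbrev TrainIndex (nt : ℕ) (N : ℕ → ℕ) : Type :=
  ((Finset.Icc 1 nt).sigma fun k => (Finset.univ : Finset (Fin (N k))))

theorem mem_Icc_trainIndex {nt : ℕ} {N : ℕ → ℕ} (q : TrainIndex nt N) :
    q.1.1 ∈ Set.Icc 1 nt := by
  simpa using (Finset.mem_sigma.1 q.2).1

/-- The matrix that picks out the observations of step `k` among all observations. -/
def trainSelect (nt : ℕ) (N : ℕ → ℕ) (k : ℕ) : Matrix (Fin (N k)) (TrainIndex nt N) ℝ :=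
  Matrix.of fun i q => if q.1 = ⟨k, i⟩ then 1 else 0

/-- The index `(k, i)`. -/
def TrainIndex.mk {nt : ℕ} {N : ℕ → ℕ} {k : ℕ} (hk : k ∈ Set.Icc 1 nt) (i : Fin (N k)) :
    TrainIndex nt N :=
  ⟨⟨k, i⟩, by simpa using hk⟩

theorem trainSelect_apply {nt : ℕ} {N : ℕ → ℕ} {k : ℕ} (hk : k ∈ Set.Icc 1 nt) (i : Fin (N k))
    (q : TrainIndex nt N) :
    trainSelect nt N k i q = if q = TrainIndex.mk hk i then 1 else 0 := by
  simp [trainSelect, TrainIndex.mk, Subtype.ext_iff]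

theorem trainSelect_mulVec {nt : ℕ} {N : ℕ → ℕ} {k : ℕ} (hk : k ∈ Set.Icc 1 nt)
    (e : TrainIndex nt N → ℝ) (i : Fin (N k)) :
    (trainSelect nt N k *ᵥ e) i = e (TrainIndex.mk hk i) := by
  simp [mulVec, dotProduct, trainSelect_apply hk]

theorem mul_trainSelect_transpose {D : Type*} {nt : ℕ} {N : ℕ → ℕ} {k : ℕ}
    (hk : k ∈ Set.Icc 1 nt) (M : Matrix D (TrainIndex nt N) ℝ) (a : D) (i : Fin (N k)) :
    (M * (trainSelect nt N k)ᵀ) a i = M a (TrainIndex.mk hk i) := by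
  simp [Matrix.mul_apply, trainSelect_apply hk]

theorem trainSelect_mul_transpose_self {nt : ℕ} {N : ℕ → ℕ} {k : ℕ} (hk : k ∈ Set.Icc 1 nt) :
    trainSelect nt N k * (trainSelect nt N k)ᵀ = 1 := by
  ext i i'
  rw [mul_trainSelect_transpose hk, trainSelect_apply hk]
  simp [TrainIndex.mk, Matrix.one_apply, eq_comm]

theorem trainSelect_mul_transpose_of_ne {nt : ℕ} {N : ℕ → ℕ} {j k : ℕ} (hj : j ∈ Set.Icc 1 nt)
    (hk : k ∈ Set.Icc 1 nt) (hjk : j ≠ k) : trainSelect nt N j * (trainSelect nt N k)ᵀ = 0 := by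
  ext i i'
  rw [mul_trainSelect_transpose hk, trainSelect_apply hj]
  simp [TrainIndex.mk, hjk.symm]

/-- This lets the noise `δ` on inputs be read as `δ` on indices, so that the noise covariance is
`σ²` times the identity. -/
theorem trainPoint_injective {T X : Type*} [LinearOrder T] {nt : ℕ} {N : ℕ → ℕ} {τ : ℕ → T}
    (hτ : StrictMonoOn τ (Set.Icc 1 nt)) {xs : ∀ k, Fin (N k) → X}
    (hxs : ∀ k ∈ Set.Icc 1 nt, Function.Injective (xs k)) :
    Function.Injective fun q : TrainIndex nt N => (τ q.1.1, xs q.1.1 q.1.2) := by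
  intro q q' h
  have hq := mem_Icc_trainIndex q
  have hq' := mem_Icc_trainIndex q'
  obtain ⟨⟨k, i⟩, hm⟩ := q
  obtain ⟨⟨k', i'⟩, hm'⟩ := q'
  simp only [Prod.mk.injEq] at h hq hq'
  obtain rfl := hτ.injOn hq hq' h.1
  obtain rfl := hxs _ hq h.2
  rfl

/-- The vectors `φ q` stand in for the noisy observations. Their Gram matrix is positive
semidefinite for free, and `hφ` splits it into the state covariance and the noise. -/
theorem isObsCov_gridObs {T : Type*} {d n : ℕ} [NeZero d] {σ : ℝ} {nt : ℕ} {τ : ℕ → T}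
    {N : ℕ → ℕ} {loc : ∀ k, Fin (N k) → Fin n} {nAct : ℕ → ℕ}
    {S : ∀ k, Matrix (Fin (N k)) (Fin (nAct k)) ℝ}
    {K : T → T → Matrix (Fin d × Fin n) (Fin d × Fin n) ℝ} (hK : ∀ t s, (K t s)ᵀ = K s t)
    {H : Type*} [NormedAddCommGroup H] [InnerProductSpace ℝ H] (φ : TrainIndex nt N → H)
    (hφ : ∀ q q', inner ℝ (φ q) (φ q') = K (τ q.1.1) (τ q'.1.1) (0, loc q.1.1 q.1.2) (0, loc q'.1.1 q'.1.2) +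
      if q = q' then σ ^ 2 else 0) :
    IsObsCov (gridObs (d := d) σ nt τ N loc nAct S) K (trainSelect nt N)
      (fun t => Matrix.of fun a q => K t (τ q.1.1) a (0, loc q.1.1 q.1.2)) (Matrix.gram ℝ φ) where
  posSemidef := Matrix.posSemidef_gram ℝ φ
  noise_symm k _ := by simp [gridObs]
  select_self k hk := trainSelect_mul_transpose_self hk
  select_of_ne j hj k hk hjk := trainSelect_mul_transpose_of_ne hj hk hjk
  cross k hk t := by
    replace hk : k ∈ Set.Icc 1 nt := hk
    have h : (Matrix.of fun a (q : TrainIndex nt N) => K t (τ q.1.1) a (0, loc q.1.1 q.1.2)) *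
        (trainSelect nt N k)ᵀ = K t (τ k) * (Matrix.of fun (i : Fin (N k)) c =>
          if c = ((0 : Fin d), loc k i) then (1 : ℝ) else 0)ᵀ := by
      ext a i
      rw [mul_trainSelect_transpose hk]
      simp [Matrix.mul_apply, TrainIndex.mk]
    exact h
  obs k hk := by
    replace hk : k ∈ Set.Icc 1 nt := hk
    have h : Matrix.gram ℝ φ * (trainSelect nt N k)ᵀ =
        (Matrix.of fun a (q : TrainIndex nt N) => K (τ k) (τ q.1.1) a (0, loc q.1.1 q.1.2))ᵀ *
          (Matrix.of fun (i : Fin (N k)) c => if c = ((0 : Fin d), loc k i) then (1 : ℝ) else 0)ᵀ +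
        (trainSelect nt N k)ᵀ * (σ ^ 2 • (1 : Matrix (Fin (N k)) (Fin (N k)) ℝ)) := by
      ext q i
      have h1 := congrFun (congrFun (hK (τ q.1.1) (τ k)) (0, loc k i)) (0, loc q.1.1 q.1.2)
      rw [transpose_apply] at h1
      rw [mul_trainSelect_transpose hk, Matrix.gram_apply, hφ, Matrix.add_apply,
        Matrix.mul_smul, Matrix.mul_one, Matrix.smul_apply, transpose_apply, trainSelect_apply hk]
      congr 1
      · simp [Matrix.mul_apply, TrainIndex.mk, ← h1]
      · rw [smul_eq_mul, mul_ite, mul_one, mul_zero]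
    exact h

end CAKS

end

/-! ### The worst-case error in the reproducing kernel Hilbert space -/

open CAKS in
theorem mainTheorem1
    -- the space-time separable Gauss–Markov prior on `[tmin, tmax] × X`
    {tmin tmax : ℝ} {X : Type*} {d : ℕ} [NeZero d]
    {Ω Ω' : Type*} [MeasurableSpace Ω] [MeasurableSpace Ω']
    (P : Measure Ω) [IsProbabilityMeasure P] (P' : Measure Ω') [IsProbabilityMeasure P']
    (f : Set.Icc tmin tmax × X → Ω → EuclideanSpace ℝ (Fin d))
    (ft : Set.Icc tmin tmax → Ω' → EuclideanSpace ℝ (Fin d))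
    (μt : Set.Icc tmin tmax → Fin d → ℝ) (μx : X → ℝ)
    (Ct : Set.Icc tmin tmax → Set.Icc tmin tmax → Matrix (Fin d) (Fin d) ℝ) (Cx : X → X → ℝ)
    (A : Set.Icc tmin tmax → Set.Icc tmin tmax → Matrix (Fin d) (Fin d) ℝ)
    (b : Set.Icc tmin tmax → Set.Icc tmin tmax → Fin d → ℝ)
    (Q : Set.Icc tmin tmax → Set.Icc tmin tmax → Matrix (Fin d) (Fin d) ℝ)
    (hf : IsSTSGMP f P ft P' μt μx Ct Cx A b Q)
    -- the reproducing kernel Hilbert space of the noisy kernel of the zeroth component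
    (σ : ℝ)
    {H : Type*} [NormedAddCommGroup H] [InnerProductSpace ℝ H] [CompleteSpace H]
    [RKHS ℝ H (Set.Icc tmin tmax × X) ℝ]
    (hH : ∀ z z', RKHS.kernel H z z' 1 = noisyKernel (fun z z' => sepCov Ct Cx z z' 0 0) σ z z')
    -- the training inputs `(τ k, xs k i)`, where `1 ≤ k ≤ nt` and `i < N k`
    (nt : ℕ) (τ : ℕ → Set.Icc tmin tmax)
    (hτ : StrictMonoOn τ (Set.Icc 1 nt)) (hτ0 : ∀ k ∈ Set.Icc 1 nt, τ 0 ≤ τ k)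
    (N : ℕ → ℕ) (xs : ∀ k, Fin (N k) → X)
    (hxs : σ ≠ 0 → ∀ k ∈ Set.Icc 1 nt, Function.Injective (xs k))
    -- the data-generating function
    (ystar : Set.Icc tmin tmax × X → ℝ)
    -- the actions; they are fixed in advance, i.e. the same for all data
    (nAct : ℕ → ℕ) (S : ∀ k, Matrix (Fin (N k)) (Fin (nAct k)) ℝ)
    -- the test input `z`, and a spatial grid that contains all spatial training and test points
    (z : Set.Icc tmin tmax × X)
    {n : ℕ} (grid : Fin n → X) (loc : ∀ k, Fin (N k) → Fin n) (j : Fin n)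
    (hloc : ∀ k ∈ Set.Icc 1 nt, ∀ i, grid (loc k i) = xs k i) (hj : grid j = z.2)
    (hz : σ = 0 ∨ ∀ k ∈ Set.Icc 1 nt, ∀ i, z ≠ (τ k, xs k i)) :
    let prior := gridPrior μt μx Ct Cx A b grid
    let obs := gridObs (d := d) σ nt τ N loc nAct S
    let μ : Set.Icc tmin tmax × X → ℝ := fun z => sepMean μt μx z 0
    -- the mean `m(z | y)₀` of the smoother for the data `y(τ k, xs k i)`
    let m : (Set.Icc tmin tmax × X → ℝ) → ℝ := fun y =>
      smootherMean prior obs (fun k i => y (τ k, xs k i)) z.1 (0, j)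
    let v : ℝ := smootherCov prior obs (fun k i => ystar (τ k, xs k i)) z.1 (0, j) (0, j)
    0 ≤ v + σ ^ 2 ∧
    (⨆ g : {g : H // g ≠ 0},
        ENNReal.ofReal (|(μ z + g.1 z) - m (fun z' => μ z' + g.1 z')| / ‖g.1‖)) =
      ENNReal.ofReal (Real.sqrt (v + σ ^ 2)) ∧
    ((∀ z', μ z' = 0) →
      (⨆ y : {y : H // y ≠ 0}, ENNReal.ofReal (|y.1 z - m y.1| / ‖y.1‖)) =
        ENNReal.ofReal (Real.sqrt (v + σ ^ 2))) := by
  intro prior obs μ m v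
  let K := gridCov Ct Cx grid
  have hK : IsMarkovCov prior K := hf.isMarkovCov grid
  let κ := noisyKernel (fun z z' => sepCov Ct Cx z z' 0 0) σ
  have hinner : ∀ z z', inner ℝ (RKHS.kerFun H z (1 : ℝ)) (RKHS.kerFun H z' 1) = κ z z' :=
    fun z z' => by rw [RKHS.kerFun_inner, RKHS.kerFun_apply, hH]; simp [κ]
  let pt : TrainIndex nt N → Set.Icc tmin tmax × X := fun q => (τ q.1.1, xs q.1.1 q.1.2)
  have hpt : σ ≠ 0 → Function.Injective pt := fun hσ q q' hqq' =>
    trainPoint_injective hτ (hxs hσ) hqq'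
  let C : Set.Icc tmin tmax → Matrix (Fin d × Fin n) (TrainIndex nt N) ℝ :=
    fun t => Matrix.of fun a q => K t (τ q.1.1) a (0, loc q.1.1 q.1.2)
  let G := Matrix.gram ℝ fun q => RKHS.kerFun H (pt q) (1 : ℝ)
  have hobs : IsObsCov obs K (trainSelect nt N) C G :=
    isObsCov_gridObs hK.symm (fun q => RKHS.kerFun H (pt q) 1) (fun q q' => by
      rw [hinner]
      simp only [κ, noisyKernel, pt, K, sepCov, gridCov, kronecker, kroneckerMap_apply, of_apply,
        hloc _ (mem_Icc_trainIndex q), hloc _ (mem_Icc_trainIndex q'), Matrix.smul_apply,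
        smul_eq_mul]
      rw [mul_comm]
      congr 1
      -- Without noise the `δ` term vanishes, so repeated training points are harmless; with noise
      -- the points are distinct.
      by_cases hσ : σ = 0
      · simp [hσ]
      · by_cases hq : q = q'
        · rw [if_pos hq, if_pos (congrArg pt hq)]
        · rw [if_neg hq, if_neg fun h => hq (hpt hσ h)])
  have hmono : ∀ j k, j ≤ k → k ≤ obs.num → obs.time j ≤ obs.time k := fun j k hjk hk => by
    rcases Nat.eq_zero_or_pos j with rfl | hj0
    · rcases Nat.eq_zero_or_pos k with rfl | hk0
      · exact le_rfl
      · exact hτ0 k ⟨hk0, hk⟩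
    · exact hτ.monotoneOn ⟨hj0, hjk.trans hk⟩ ⟨hj0.trans_le hjk, hk⟩ hjk
  have hspec := fun y : Set.Icc tmin tmax × X → ℝ =>
    caksAt_spec (e := fun q => y (pt q) - μ (pt q)) (y := fun k i => y (τ k, xs k i)) hK hobs
      hmono (fun k hk => by
        replace hk : k ∈ Set.Icc 1 nt := hk
        have h : trainSelect nt N k *ᵥ (fun q => y (pt q) - μ (pt q)) =
            (fun i => y (τ k, xs k i)) - (Matrix.of fun (i : Fin (N k)) c =>
              if c = ((0 : Fin d), loc k i) then (1 : ℝ) else 0) *ᵥ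
                fun c => μt (τ k) c.1 * μx (grid c.2) := by
          ext i
          rw [trainSelect_mulVec hk]
          simp [mulVec, dotProduct, TrainIndex.mk, pt, μ, sepMean, hloc k hk, mul_comm]
        exact h) z.1
  -- The weights involve the prior, the inputs and the actions, but no data.
  let c : TrainIndex nt N → ℝ := postWeight obs K (trainSelect nt N) nt z.1 (0, j)
  let h : H := RKHS.kerFun H z 1 - ∑ q, c q • RKHS.kerFun H (pt q) 1
  have hμ : prior.mean z.1 (0, j) = μ z := by
    simp [prior, gridPrior, μ, sepMean, hj, mul_comm]
  have hm : ∀ y : Set.Icc tmin tmax × X → ℝ, m y = μ z + ∑ q, c q * (y (pt q) - μ (pt q)) :=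
    fun y => by
      rw [← hμ]
      exact congrFun (hspec y).1 (0, j)
  have herr : ∀ g : H, inner ℝ h g = g z - ∑ q, c q * g (pt q) := fun g => by
    simp [h, inner_sub_left, sum_inner, inner_smul_left]
  -- Here the condition on `z` enters: without it the noise would also appear in the cross terms.
  have hcross : ∀ q, κ z (pt q) = K z.1 (τ q.1.1) (0, j) (0, loc q.1.1 q.1.2) := fun q => by
    have h0 : κ z (pt q) = sepCov Ct Cx z (pt q) 0 0 := by
      rcases hz with hσ | hz
      · simp [κ, noisyKernel, hσ]
      · simp only [κ, noisyKernel]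
        rw [if_neg (hz _ (mem_Icc_trainIndex q) _), add_zero]
    rw [h0]
    simp only [K, gridCov, kronecker, kroneckerMap_apply, of_apply,
      hloc _ (mem_Icc_trainIndex q), hj, sepCov, Matrix.smul_apply, smul_eq_mul, pt, mul_comm]
  have hdiag : κ z z = K z.1 z.1 (0, j) (0, j) + σ ^ 2 := by
    simp [κ, noisyKernel, K, gridCov, hj, sepCov, mul_comm]
  have hv : v + σ ^ 2 = ‖h‖ ^ 2 := by
    -- The data `ystar` disappear because `postCov` does not involve data.
    have h1 : v = errorCov K C G (postWeight obs K (trainSelect nt N) nt) z.1 z.1 (0, j) (0, j) := by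
      rw [hobs.errorCov_postWeight (k := nt) hK.symm le_rfl]
      exact congrFun (congrFun (hspec ystar).2 (0, j)) (0, j)
    have h2 : ‖h‖ ^ 2 = κ z z - ∑ q, κ z (pt q) * c q - ∑ q, c q * κ z (pt q) +
        ∑ q, (∑ q', c q' * κ (pt q') (pt q)) * c q := by
      rw [← real_inner_self_eq_norm_sq]
      simp only [h, inner_sub_left, inner_sub_right, sum_inner, inner_sum, inner_smul_left,
        inner_smul_right, hinner, Finset.sum_mul, RCLike.conj_to_real]
      have h3 : ∀ q, κ (pt q) z = κ z (pt q) := fun q => by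
        rw [← hinner, real_inner_comm, hinner]
      have h4 : ∀ q, κ z (pt q) * c q = c q * κ z (pt q) := fun q => mul_comm _ _
      have h5 : ∀ q q', c q' * κ (pt q') (pt q) * c q = c q * (c q' * κ (pt q') (pt q)) :=
        fun q q' => by ring
      simp only [h3, h4, h5, mul_sub, Finset.sum_sub_distrib, Finset.mul_sum]
      ring
    rw [h1, h2, hdiag]
    simp only [hcross]
    simp only [errorCov, C, G, Matrix.add_apply, Matrix.sub_apply, Matrix.mul_apply, transpose_apply,
      of_apply, Matrix.gram_apply, hinner]
    change _ - _ - _ + _ + _ = _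
    ring
  have hsqrt : Real.sqrt (v + σ ^ 2) = ‖h‖ := by rw [hv, Real.sqrt_sq (norm_nonneg _)]
  have hnonneg : 0 ≤ v + σ ^ 2 := hv ▸ sq_nonneg _
  clear_value m v h c
  refine ⟨hnonneg, ?_, fun hμ0 => ?_⟩
  · rw [hsqrt, ← iSup_abs_inner_div_norm h]
    refine iSup_congr fun g => ?_
    refine congrArg (fun x => ENNReal.ofReal (|x| / ‖g.1‖)) ?_
    rw [herr]
    refine (congrArg (μ z + g.1 z - ·) (hm fun z' => μ z' + g.1 z')).trans ?_
    simp only [add_sub_cancel_left]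
    ring
  · rw [hsqrt, ← iSup_abs_inner_div_norm h]
    refine iSup_congr fun g => ?_
    rw [hm, herr]
    simp [hμ0]
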